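/- **Letters.** Let $A=\{1,x,x'\}$ with the involution $1'=1$, $(x)'=x'$, $(x')'=x$; the elements of $A$ are called anchors. Write the entries of a 5-tuple $g$ as $g=(g^l,g^{la},g^c,g^{ra},g^r)$; superscripts are composed, e.g. $g^{cl}=(g^c)^l$. Let $g_{xx'}=(1,1,x,x',1)$, $G_{1,e}=\{g_{xx'}\}$, $G_{1,d}=G_{2,d}=\emptyset$, and for $i\ge 2$ $$G_{i,e}=\{(g,(g^{la})',g^l,(g^{ra})',g),\ (g,(g^{ra})',g^l,(g^{la})',g)\ :\ g\in G_{i-1,e}\}.$$ Put $G_i=G_{i,e}\cup G_{i,d}$, where for $i\ge 3$ the set $G_{i,d}$ consists of all $g\in G_{i-1}\times A\times G_{i-2}\times A\times G_{i-1}$ such that $g^l\ne g^r$, $(g^c,g^{la})\in\{(g^{ll},(g^{lla})'),(g^{lr},(g^{lra})')\}$ and $(g^c,g^{ra})\in\{(g^{rl},(g^{rla})'),(g^{rr},(g^{rra})')\}$. Let $G^5=\bigcup_{i\ge1}G_i$, $G'=G^5\cup\{1\}$ and $G=G^5\cup A$. The height of $1$ is $0$, and the height of $g\in G_i$ is $i$.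 **Presentation.** For $g\in G^5$ let $g^L$ and $g^R$ be the words $(g^{la})'g^lg^{la}$ and $(g^{ra})'g^rg^{ra}$. Let $\rho$ be the smallest congruence on the free semigroup $G^+$ that contains the pairs - $(xx'x,x)$, $(x'xx',x')$, $(g_{xx'},xx')$; $(1g,g)$ and $(g1,g)$ for all $g\in G$; $(gg,g)$ for all $g\in G'$; - $(g^cg^Lg,g)$, $(gg^Rg^c,g)$ and $(g^r g^{ra}\,g\,(g^{la})'g^l,\ g^r g^{ra}\,g^c\,(g^{la})'g^l)$ for all $g\in G^5$ of height at least $2$. Let $F_1^1=G^+/\rho$, and let $[u]$ be the $\rho$-class of $u\in G^+$. **Landscapes and mountains.** A triplet $hag$ with $h\in G'$, $a\in A$, $g\in G^5$ is left anchored if $(h,a)\in\{(g^l,g^{la}),(g^r,g^{ra})\}$, and $gah$ is right anchored if $(h,a)\in\{(g^l,(g^{la})'),(g^r,(g^{ra})')\}$. A landscape is a word $g_0a_1g_1\cdots a_ng_n$ ($n\ge0$, $g_i\in G'$, $a_i\in A$) in which every triplet $g_{i-1}a_ig_i$ is left or right anchored. A river of it is a letter $g_i$, $0<i<n$, such that both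 $g_{i-1}$ and $g_{i+1}$ have height one more than $g_i$. A mountain is a landscape without rivers with $g_0=g_n=1$. *Uplifting* the river $g_i$ means: if $g_{i-1}=g_{i+1}$ and $a_i=a_{i+1}'$, replace the subword $g_{i-1}a_ig_ia_{i+1}g_{i+1}$ by $g_{i-1}$; otherwise replace the letter $g_i$ by the letter $(g_{i+1},a_{i+1}',g_i,a_i,g_{i-1})$. **The map $\beta$.** For landscapes $u_1,u_2$ such that the last letter of $u_1$ is the first letter of $u_2$, let $u_1*u_2$ be $u_1u_2$ with one of these two adjacent letters deleted. Let $\lambda_l(1)=\lambda_r(1)=1$, $\lambda_l(g_{xx'})=1\,1\,g_{xx'}$, $\lambda_r(g_{xx'})=g_{xx'}\,1\,1$, and for $g\in G^5$ of height at least $2$ $$\lambda_l(g)=\lambda_l(g^c)\,(g^{la})'\,g^l\,g^{la}\,g,\qquad \lambda_r(g)=g\,(g^{ra})'\,g^r\,g^{ra}\,\lambda_r(g^c).$$ Put $\beta_1(1)=1$, $\beta_1(x)=1\,1\,g_{xx'}\,x\,1$, $\beta_1(x')=1\,x'\,g_{xx'}\,1\,1$, $\beta_1(g)=\lambda_l(g)*\lambda_r(g)$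 for $g\in G^5$, and $\beta_1(h_0\cdots h_k)=\beta_1(h_0)*\cdots*\beta_1(h_k)$ for $h_0,\dots,h_k\in G$. **Theorem.** 1. For each $u\in G^+$ there is exactly one word without rivers that can be reached from $\beta_1(u)$ by a finite (possibly empty) sequence of upliftings of rivers. This word, denoted by $\beta(u)$, is a mountain. 2. For all $u,v\in G^+$: $[u]=[v]$ if and only if $\beta(u)=\beta(v)$. 3. For each $u\in G^+$, the word $\beta(u)$ is the unique mountain in the $\rho$-class $[u]$. 4. The word problem for the presentation of $F_1^1$ is decidable: encode letters injectively by natural numbers through a standard Gödel numbering of nested tuples, and words by the lists of the numbers of their letters; then there is an algorithm that decides, for any two lists of natural numbers, whether they encode words $u,v\in G^+$ with $[u]=[v]$. -/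

import Mathlib

namespace FreeRegOne

/-- The set `A = {1, x, x'}` of anchors. -/
inductive Anchor
  | one
  | x
  | xinv
  deriving DecidableEq

/-- The involution `a ↦ a'` of `A`, where `1' = 1`. -/
def Anchor.inv : Anchor → Anchor
  | .one => .one
  | .x => .xinv
  | .xinv => .x

/-- A number for each anchor. -/
def Anchor.code : Anchor → ℕ
  | .one => 0
  | .x => 1
  | .xinv => 2

/-- Formal symbols: an anchor, or a 5-tuple `(g^l, g^la, g^c, g^ra, g^r)` whose left, middle and
right entries are symbols and whose other two entries are anchors. The generators in `G` are
particular symbols. -/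
inductive Symb
  | anc (a : Anchor)
  | tup (l : Symb) (la : Anchor) (c : Symb) (ra : Anchor) (r : Symb)
  deriving DecidableEq

namespace Symb

/-- The letter `1`. -/
def one : Symb := anc .one

/-- The left entry `g^l` (a dummy value if the symbol is not a 5-tuple). -/
def l : Symb → Symb
  | anc _ => one
  | tup l _ _ _ _ => l

/-- The left anchor `g^la`. -/
def la : Symb → Anchor
  | anc _ => .one
  | tup _ la _ _ _ => la

/-- The middle entry `g^c`. -/
def c : Symb → Symb
  | anc _ => one
  | tup _ _ c _ _ => c

/-- The right anchor `g^ra`. -/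
def ra : Symb → Anchor
  | anc _ => .one
  | tup _ _ _ ra _ => ra

/-- The right entry `g^r`. -/
def r : Symb → Symb
  | anc _ => one
  | tup _ _ _ _ r => r

/-- The 5-tuple `g_{xx'} = (1, 1, x, x', 1)`. -/
def gxx : Symb := tup one .one (anc .x) .xinv one

/-- The set `G_{i,e}` for `i ≥ 1` (the index `0` is not used). -/
def GE : ℕ → Set Symb
  | 0 => ∅
  | 1 => {gxx}
  | i + 2 => {h | ∃ g ∈ GE (i + 1),
      h = tup g g.la.inv g.l g.ra.inv g ∨ h = tup g g.ra.inv g.l g.la.inv g}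

/-- The set `G_{i,d}` for `i ≥ 1` (the index `0` is not used). Here `G_i = G_{i,e} ∪ G_{i,d}`. -/
def GD : ℕ → Set Symb
  | 0 => ∅
  | 1 => ∅
  | 2 => ∅
  | i + 3 => {g | ∃ l la c ra r, g = tup l la c ra r ∧
      l ∈ GE (i + 2) ∪ GD (i + 2) ∧ c ∈ GE (i + 1) ∪ GD (i + 1) ∧ r ∈ GE (i + 2) ∪ GD (i + 2) ∧
      l ≠ r ∧
      ((c, la) = (l.l, l.la.inv) ∨ (c, la) = (l.r, l.ra.inv)) ∧
      ((c, ra) = (r.l, r.la.inv) ∨ (c, ra) = (r.r, r.ra.inv))}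

/-- The set `G_i = G_{i,e} ∪ G_{i,d}`, `i ≥ 1`. -/
def level (i : ℕ) : Set Symb := GE i ∪ GD i

/-- The set `G^5` of all 5-tuples that are generators. -/
def G5 : Set Symb := {g | ∃ i, 1 ≤ i ∧ g ∈ level i}

/-- The set of generators `G = G^5 ∪ A`. -/
def G : Set Symb := G5 ∪ Set.range anc

/-- The height; it is `0` at `1` and `i` on `G_i`, see `height_of_mem_level`. -/
def height : Symb → ℕ
  | anc _ => 0
  | tup l _ _ _ _ => l.height + 1

/-- A Gödel numbering of the symbols, see `code_injective`. -/
def code : Symb → ℕ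
  | anc a => a.code
  | tup l la c ra r =>
      3 + Nat.pair l.code (Nat.pair la.code (Nat.pair c.code (Nat.pair ra.code r.code)))

theorem code_injective : Function.Injective code := by
  have hA : ∀ a : Anchor, a.code < 3 := by intro a; cases a <;> decide
  have hinj : ∀ a b : Anchor, a.code = b.code → a = b := by
    intro a b; cases a <;> cases b <;> simp [Anchor.code]
  intro s
  induction s with
  | anc a =>
    intro t h
    cases t with
    | anc b => rw [hinj a b h]
    | tup l la c ra r => have := hA a; simp only [code] at h; omega
  | tup l la c ra r ihl ihc ihr =>
    intro t h
    cases t with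
    | anc b => have := hA b; simp only [code] at h; omega
    | tup l' la' c' ra' r' =>
      simp only [code, Nat.add_left_cancel_iff, Nat.pair_eq_pair] at h
      obtain ⟨h1, h2, h3, h4, h5⟩ := h
      rw [ihl h1, hinj _ _ h2, ihc h3, hinj _ _ h4, ihr h5]

theorem height_of_mem_level : ∀ (i : ℕ) (g : Symb), g ∈ level i → g.height = i
  | 0, g, h => by simp [level, GE, GD] at h
  | 1, g, h => by
      simp only [level, GE, GD, Set.union_empty, Set.mem_singleton_iff] at h
      subst h; rfl
  | 2, g, h => by
      simp only [level, GE, GD, Set.union_empty, Set.mem_singleton_iff, Set.mem_ofPred_eq] at h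
      obtain ⟨k, rfl, h | h⟩ := h <;> subst h <;> rfl
  | i + 3, g, h => by
      have ih := height_of_mem_level (i + 2)
      rcases h with h | h
      · obtain ⟨k, hk, h | h⟩ := h <;> subst h <;>
          simp only [height, ih k (Or.inl hk)]
      · simp only [GD, Set.mem_ofPred_eq] at h
        obtain ⟨l, la, c, ra, r, rfl, hl, -⟩ := h
        simp only [height, ih l hl]

theorem entries_mem_G : ∀ (i : ℕ) (g : Symb), g ∈ level i → g.l ∈ G ∧ g.c ∈ G ∧ g.r ∈ G
  | 0, g, h => by simp [level, GE, GD] at h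
  | 1, g, h => by
      simp only [level, GE, GD, Set.union_empty, Set.mem_singleton_iff] at h
      subst h
      exact ⟨Or.inr ⟨_, rfl⟩, Or.inr ⟨_, rfl⟩, Or.inr ⟨_, rfl⟩⟩
  | i + 2, g, h => by
      rcases h with h | h
      · obtain ⟨k, hk, h | h⟩ := h <;> subst h <;>
          exact ⟨Or.inl ⟨i + 1, by omega, Or.inl hk⟩,
            (entries_mem_G (i + 1) k (Or.inl hk)).1,
            Or.inl ⟨i + 1, by omega, Or.inl hk⟩⟩
      · cases i with
        | zero => simp [GD] at h
        | succ i =>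
          simp only [GD, Set.mem_ofPred_eq] at h
          obtain ⟨l, la, c, ra, r, rfl, hl, hc, hr, -⟩ := h
          exact ⟨Or.inl ⟨i + 2, by omega, hl⟩, Or.inl ⟨i + 1, by omega, hc⟩,
            Or.inl ⟨i + 2, by omega, hr⟩⟩

theorem anc_mem_G (a : Anchor) : anc a ∈ G := Or.inr ⟨a, rfl⟩

theorem l_mem_G {g : Symb} (h : g ∈ G) : g.l ∈ G := by
  rcases h with ⟨i, -, h⟩ | ⟨a, rfl⟩
  · exact (entries_mem_G i g h).1
  · exact anc_mem_G _

theorem c_mem_G {g : Symb} (h : g ∈ G) : g.c ∈ G := by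
  rcases h with ⟨i, -, h⟩ | ⟨a, rfl⟩
  · exact (entries_mem_G i g h).2.1
  · exact anc_mem_G _

theorem r_mem_G {g : Symb} (h : g ∈ G) : g.r ∈ G := by
  rcases h with ⟨i, -, h⟩ | ⟨a, rfl⟩
  · exact (entries_mem_G i g h).2.2
  · exact anc_mem_G _

theorem gxx_mem_G : gxx ∈ G := Or.inl ⟨1, le_rfl, Or.inl rfl⟩

end Symb

/-- The generators, i.e. the letters from `G = G^5 ∪ A`. -/
abbrev Gen : Type := {g : Symb // g ∈ Symb.G}

namespace Gen

/-- An anchor as a letter; the letter `1` is `anc .one`. -/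
def anc (a : Anchor) : Gen := ⟨.anc a, Symb.anc_mem_G a⟩

/-- The letter `g_{xx'}`. -/
def gxx : Gen := ⟨Symb.gxx, Symb.gxx_mem_G⟩

/-- `g^l` -/
def l (g : Gen) : Gen := ⟨g.1.l, Symb.l_mem_G g.2⟩

/-- `g^c` -/
def c (g : Gen) : Gen := ⟨g.1.c, Symb.c_mem_G g.2⟩

/-- `g^r` -/
def r (g : Gen) : Gen := ⟨g.1.r, Symb.r_mem_G g.2⟩

/-- `g^la` -/
def la (g : Gen) : Anchor := g.1.la

/-- `g^ra` -/
def ra (g : Gen) : Anchor := g.1.ra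

/-- The height of a letter of `G'`. -/
def height (g : Gen) : ℕ := g.1.height

/-- `g ∈ G^5` -/
def IsTuple (g : Gen) : Prop := g.1 ∈ Symb.G5

/-- `g ∈ G' = G^5 ∪ {1}` -/
def IsVertex (g : Gen) : Prop := g.IsTuple ∨ g = anc .one

end Gen

/-- The free semigroup `G^+`. -/
abbrev Word : Type := FreeSemigroup Gen

namespace Word

/-- The one-letter word. -/
def of (g : Gen) : Word := FreeSemigroup.of g

/-- The one-letter word given by an anchor. -/
def anc (a : Anchor) : Word := FreeSemigroup.of (Gen.anc a)

/-- The letters of a word, in order. -/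
def letters (u : Word) : List Gen := u.head :: u.tail

/-- `u₁ * u₂`: the product `u₁ u₂` with the first letter of `u₂` left out (in all uses this letter
is the last letter of `u₁`). -/
def star (u₁ u₂ : Word) : Word := ⟨u₁.head, u₁.tail ++ u₂.tail⟩

end Word

/-- The word `g^L = (g^la)' g^l g^la`. -/
def wordL (g : Gen) : Word := Word.anc g.la.inv * Word.of g.l * Word.anc g.la

/-- The word `g^R = (g^ra)' g^r g^ra`. -/
def wordR (g : Gen) : Word := Word.anc g.ra.inv * Word.of g.r * Word.anc g.ra

/-- The relations `ρ_e`: `x'` is an inverse of `x`, `g_{xx'} = xx'`, the letter `1` is an identity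
element, and the letters of `G'` are idempotent. -/
inductive RelE : Word → Word → Prop
  | x_reg : RelE (Word.anc .x * Word.anc .xinv * Word.anc .x) (Word.anc .x)
  | xinv_reg : RelE (Word.anc .xinv * Word.anc .x * Word.anc .xinv) (Word.anc .xinv)
  | gxx_eq : RelE (Word.of Gen.gxx) (Word.anc .x * Word.anc .xinv)
  | one_mul (g : Gen) : RelE (Word.anc .one * Word.of g) (Word.of g)
  | mul_one (g : Gen) : RelE (Word.of g * Word.anc .one) (Word.of g)
  | idem (g : Gen) (hg : g.IsVertex) : RelE (Word.of g * Word.of g) (Word.of g)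

/-- The relations `ρ_s`. -/
inductive RelS : Word → Word → Prop
  | left (g : Gen) (hg : g.IsTuple) (h2 : 2 ≤ g.height) :
      RelS (Word.of g.c * wordL g * Word.of g) (Word.of g)
  | right (g : Gen) (hg : g.IsTuple) (h2 : 2 ≤ g.height) :
      RelS (Word.of g * wordR g * Word.of g.c) (Word.of g)
  | middle (g : Gen) (hg : g.IsTuple) (h2 : 2 ≤ g.height) :
      RelS (Word.of g.r * Word.anc g.ra * Word.of g * Word.anc g.la.inv * Word.of g.l)
        (Word.of g.r * Word.anc g.ra * Word.of g.c * Word.anc g.la.inv * Word.of g.l)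

/-- The smallest congruence `ρ` on `G^+` that contains `ρ_e ∪ ρ_s`. -/
def rho : Con Word := conGen fun u v => RelE u v ∨ RelS u v

/-- The semigroup `F_1^1 = G^+ / ρ`. -/
abbrev FOneOne : Type := rho.Quotient

/-- The `ρ`-class `[u]` of a word. -/
def cls (u : Word) : FOneOne := (u : rho.Quotient)

/-- `g₁ a g` is left anchored. -/
def LeftAnchored (g₁ : Gen) (a : Anchor) (g : Gen) : Prop :=
  g.IsTuple ∧ ((g₁, a) = (g.l, g.la) ∨ (g₁, a) = (g.r, g.ra))

/-- `g a g₁` is right anchored. -/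
def RightAnchored (g : Gen) (a : Anchor) (g₁ : Gen) : Prop :=
  g.IsTuple ∧ ((g₁, a) = (g.l, g.la.inv) ∨ (g₁, a) = (g.r, g.ra.inv))

/-- The triplet `g a h` is anchored. -/
def Anchored (g : Gen) (a : Anchor) (h : Gen) : Prop :=
  LeftAnchored g a h ∨ RightAnchored g a h

/-- Landscapes: words `g₀ a₁ g₁ ⋯ aₙ gₙ` of letters of `G'` and anchors alternately, in which all
triplets `g_{i-1} a_i g_i` are anchored. -/
inductive IsLandscape : Word → Prop
  | single (g : Gen) (hg : g.IsVertex) : IsLandscape (Word.of g)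
  | cons (g : Gen) (hg : g.IsVertex) (a : Anchor) (w : Word) (h : Anchored g a w.head)
      (hw : IsLandscape w) : IsLandscape (Word.of g * Word.anc a * w)

/-- The letter `g` at the indicated place of the word `u = p g₁ a g b g₂ s`, regarded as a
landscape, is a river; as `p` has even length, `g₁`, `g`, `g₂` are letters at `G'`-positions. -/
def RiverAt (u : Word) (p : List Gen) (g₁ : Gen) (a : Anchor) (g : Gen) (b : Anchor) (g₂ : Gen)
    (s : List Gen) : Prop :=
  u.letters = p ++ [g₁, Gen.anc a, g, Gen.anc b, g₂] ++ s ∧ Even p.length ∧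
    g₁.height = g.height + 1 ∧ g₂.height = g.height + 1

/-- The landscape `u` has a river. -/
def HasRiver (u : Word) : Prop := ∃ p g₁ a g b g₂ s, RiverAt u p g₁ a g b g₂ s

/-- `u → v`: the word `v` is obtained from the landscape `u` by uplifting a river. -/
def Uplift (u v : Word) : Prop :=
  IsLandscape u ∧ ∃ p g₁ a g b g₂ s, RiverAt u p g₁ a g b g₂ s ∧
    (((g₁ = g₂ ∧ a = b.inv) ∧ v.letters = p ++ [g₁] ++ s) ∨
      (¬ (g₁ = g₂ ∧ a = b.inv) ∧ ∃ h : Gen, h.1 = .tup g₂.1 b.inv g.1 a g₁.1 ∧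
        v.letters = p ++ [g₁, Gen.anc a, h, Gen.anc b, g₂] ++ s))

/-- Mountain ranges: landscapes whose first and last letter is `1`. -/
def IsMountainRange (u : Word) : Prop :=
  IsLandscape u ∧ u.letters.head? = some (Gen.anc .one) ∧
    u.letters.getLast? = some (Gen.anc .one)

/-- Mountains: mountain ranges without rivers. -/
def IsMountain (u : Word) : Prop := IsMountainRange u ∧ ¬ HasRiver u

/-- The left hill of the mountain attached to a letter `g ∈ G'` of the given height. The anchor
`g^{l_a a}` of `g^c` in `g^l` with respect to `g` is `(g^la)'`. -/
def hillL : ℕ → Gen → Word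
  | 0, g => Word.of g
  | 1, g => Word.anc .one * Word.anc .one * Word.of g
  | n + 2, g => hillL n g.c * Word.anc g.la.inv * Word.of g.l * Word.anc g.la * Word.of g

/-- The right hill of the mountain attached to a letter `g ∈ G'` of the given height. The anchor
`(g^{r_a a})'` is `g^ra`. -/
def hillR : ℕ → Gen → Word
  | 0, g => Word.of g
  | 1, g => Word.of g * Word.anc .one * Word.anc .one
  | n + 2, g => Word.of g * Word.anc g.ra.inv * Word.of g.r * Word.anc g.ra * hillR n g.c

/-- The mountain `β₁(g)` attached to a letter. -/
def beta1Letter (g : Gen) : Word :=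
  match g.1 with
  | .anc .one => Word.anc .one
  | .anc .x =>
      Word.anc .one * Word.anc .one * Word.of Gen.gxx * Word.anc .x * Word.anc .one
  | .anc .xinv =>
      Word.anc .one * Word.anc .xinv * Word.of Gen.gxx * Word.anc .one * Word.anc .one
  | .tup _ _ _ _ _ => (hillL g.height g).star (hillR g.height g)

/-- `β₁(h₀ ⋯ h_k) = β₁(h₀) * ⋯ * β₁(h_k)`. -/
def beta1 (u : Word) : Word :=
  u.tail.foldl (fun w g => w.star (beta1Letter g)) (beta1Letter u.head)

/-- `m` is a river-free word that can be reached from `β₁(u)` by uplifting rivers. -/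
def IsNormalForm (u m : Word) : Prop :=
  Relation.ReflTransGen Uplift (beta1 u) m ∧ ¬ HasRiver m

/-- `β(u)`: the river-free word that is reached from `β₁(u)` by uplifting rivers. -/
noncomputable def beta (u : Word) : Word :=
  @Classical.epsilon Word ⟨Word.anc .one⟩ (IsNormalForm u)

/-- A word, coded as the list of the numbers of its letters. -/
def wordCode (u : Word) : List ℕ := u.letters.map fun g => g.1.code

/-- The word problem of the presentation is decidable: there is an algorithm that decides, for two
lists of numbers, whether they are the codes of two words over `G` with the same `ρ`-class. -/
def WordProblemDecidable : Prop :=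
  ComputablePred fun p : List ℕ × List ℕ =>
    ∃ u v : Word, wordCode u = p.1 ∧ wordCode v = p.2 ∧ cls u = cls v

end FreeRegOne

namespace FreeRegOne

/-! A landscape is a path in a graph: its vertices are the letters of `G'` and its edges are the
anchored triplets. The height changes by one along every edge, so each edge goes either up or down.
A river is a descending edge `d` followed by an ascending edge `u`. If `d` is the reverse of `u`,
uplifting deletes both. Otherwise the letter spanned by the river is again in `G^5`, and every
letter of height at least 2 arises in this way from exactly one river (`Edge.River.peak_val`,
`Gen.lift_eq`).

Uniqueness of the normal form: two rivers never share an edge, so upliftings of different rivers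
commute (`Step.diamond`) and the rewriting is confluent. Existence: when an edge is appended to a
path that goes up and then down, one right-to-left pass restores that shape (`UpDown.push`). No
separate termination argument is needed, and the procedure `normalize` is explicit.

Connection with `ρ`: uplifting does not change the `ρ`-class (`Step.cls_eq`), and `β₁(u)` lies in
the class of `u` (`cls_betaPath`). Hence `β(u) = β(v)` implies `[u] = [v]`. For the converse, `u ↦
β₁(u)` modulo uplifting must respect all relations. The crux is `Gen.bridge_down`: the right hill of
`g`, then `β₁(a)`, then the left hill of `h` lifts to the single edge `g a h`. Consequently `β₁` of
a landscape from `g` to `k` is equivalent to that landscape between the left hill of `g` and the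
right hill of `k` (`pathCls_betaPath_toWord`), and the relations `ρ_s` become the recursion for the
hills and the uplifting of a river. Since the hills of `1` are empty, a mountain is its own normal
form, which makes it the only mountain in its class.

Decidability: on Gödel numbers, membership in `G`, the paths `β₁(g)` and `normalize` are all
primitive recursive. -/

theorem Anchor.inv_inv (a : Anchor) : a.inv.inv = a := by cases a <;> rfl

theorem Anchor.inv_injective : Function.Injective Anchor.inv :=
  fun a b h => by rw [← a.inv_inv, h, b.inv_inv]

/-! ### A description of `G^5` without levels -/

namespace Symb

/-- `(c, a)` is one of the two pairs leading down from the tuple `g`. -/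
def IsDown (g c : Symb) (a : Anchor) : Prop :=
  (c, a) = (g.l, g.la.inv) ∨ (c, a) = (g.r, g.ra.inv)

/-- A level-free description of the tuples of `G⁵`. -/
inductive Tuple : Symb → Prop
  | gxx : Tuple gxx
  | tup (l : Symb) (la : Anchor) (c : Symb) (ra : Anchor) (r : Symb) (hl : Tuple l) (hr : Tuple r)
      (hcl : IsDown l c la) (hcr : IsDown r c ra) (hne : (l, la) ≠ (r, ra)) :
      Tuple (tup l la c ra r)

theorem GE_l_eq_r : ∀ (i : ℕ) (g : Symb), g ∈ GE i → g.l = g.r ∧ g.la ≠ g.ra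
  | 0, _, h => by simp [GE] at h
  | 1, _, h => by
      simp only [GE, Set.mem_singleton_iff] at h
      subst h
      exact ⟨rfl, by decide⟩
  | i + 2, g, h => by
      obtain ⟨k, hk, h⟩ := h
      have := (GE_l_eq_r (i + 1) k hk).2
      rcases h with rfl | rfl
      · exact ⟨rfl, fun e => this (Anchor.inv_injective e)⟩
      · exact ⟨rfl, fun e => this (Anchor.inv_injective e).symm⟩

/-- Letters of `GE` have equal outer entries but distinct outer anchors, and letters of `GD` have
distinct outer entries. The single condition `(l, la) ≠ (r, ra)` covers both kinds. -/
theorem tuple_of_mem_level : ∀ (i : ℕ) (g : Symb), g ∈ level i → Tuple g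
  | 0, _, h => by simp [level, GE, GD] at h
  | 1, _, h => by
      simp only [level, GE, GD, Set.union_empty, Set.mem_singleton_iff] at h
      subst h
      exact .gxx
  | i + 2, g, h => by
      rcases h with ⟨k, hk, h⟩ | h
      · have ih := tuple_of_mem_level (i + 1) k (Or.inl hk)
        obtain ⟨h1, h2⟩ := GE_l_eq_r (i + 1) k hk
        have h3 : k.la.inv ≠ k.ra.inv := fun e => h2 (Anchor.inv_injective e)
        rcases h with rfl | rfl
        · exact .tup _ _ _ _ _ ih ih (Or.inl rfl) (Or.inr (by rw [h1])) (by simpa using h3)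
        · exact .tup _ _ _ _ _ ih ih (Or.inr (by rw [h1])) (Or.inl rfl) (by simpa using h3.symm)
      · cases i with
        | zero => simp [GD] at h
        | succ i =>
          simp only [GD, Set.mem_ofPred_eq] at h
          obtain ⟨l, la, c, ra, r, rfl, hl, -, hr, hne, h1, h2⟩ := h
          exact .tup _ _ _ _ _ (tuple_of_mem_level (i + 2) l hl) (tuple_of_mem_level (i + 2) r hr)
            h1 h2 (fun e => hne (Prod.ext_iff.1 e).1)

/-- The entries leading down from a letter of level `i + 2` are of level `i + 1`. -/
theorem down_mem_level {i : ℕ} {g c : Symb} {a : Anchor} (h : g ∈ level (i + 2))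
    (hc : IsDown g c a) : c ∈ level (i + 1) := by
  have key : g.l ∈ level (i + 1) ∧ g.r ∈ level (i + 1) := by
    rcases h with ⟨k, hk, rfl | rfl⟩ | h
    · exact ⟨Or.inl hk, Or.inl hk⟩
    · exact ⟨Or.inl hk, Or.inl hk⟩
    · cases i with
      | zero => simp [GD] at h
      | succ i =>
        simp only [GD, Set.mem_ofPred_eq] at h
        obtain ⟨l, la, c, ra, r, rfl, hl, -, hr, -⟩ := h
        exact ⟨hl, hr⟩
  rcases hc with hc | hc
  · rw [show c = g.l from (Prod.ext_iff.1 hc).1]; exact key.1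
  · rw [show c = g.r from (Prod.ext_iff.1 hc).1]; exact key.2

theorem eq_gxx_of_mem_level_one {g : Symb} (h : g ∈ level 1) : g = gxx := by
  simpa [level, GE, GD] using h

theorem down_gxx {c : Symb} {a : Anchor} (hc : IsDown gxx c a) : c = one := by
  rcases hc with hc | hc <;> exact (Prod.ext_iff.1 hc).1

theorem height_down {i : ℕ} {g c : Symb} {a : Anchor} (h : g ∈ level (i + 1))
    (hc : IsDown g c a) : c.height = i := by
  cases i with
  | zero =>
    rw [eq_gxx_of_mem_level_one h] at hc
    rw [down_gxx hc]; rfl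
  | succ i => exact height_of_mem_level _ _ (down_mem_level h hc)

/-- Both outer entries lie directly above `c`, so they have a common level. The tuple belongs to
`GE` or to `GD` according to whether they are equal. -/
theorem Tuple.exists_level {g : Symb} (h : Tuple g) : ∃ i, g ∈ level (i + 1) := by
  induction h with
  | gxx => exact ⟨0, Or.inl rfl⟩
  | tup l la c ra r hl hr hcl hcr hne ihl ihr =>
    obtain ⟨i, hi⟩ := ihl
    obtain ⟨j, hj⟩ := ihr
    obtain rfl : i = j := (height_down hi hcl).symm.trans (height_down hj hcr)
    refine ⟨i + 1, ?_⟩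
    by_cases hlr : l = r
    · subst hlr
      have hla : la ≠ ra := fun e => hne (by rw [e])
      have hE : l ∈ GE (i + 1) := by
        rcases hi with hi | hi
        · exact hi
        -- A letter of `GD` has distinct outer entries, so the entry `c` below it determines the
        -- anchor. This would force `la = ra`.
        · exfalso
          match i, hi with
          | 0, hi => simp [GD] at hi
          | 1, hi => simp [GD] at hi
          | i + 2, hi =>
            simp only [GD, Set.mem_ofPred_eq] at hi
            obtain ⟨l1, la1, c1, ra1, r1, rfl, -, -, -, h1, -⟩ := hi
            simp only [IsDown, Symb.l, Symb.la, Symb.r, Symb.ra, Prod.mk.injEq] at hcl hcr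
            grind
      have h1 := (GE_l_eq_r _ _ hE).1
      left
      refine ⟨l, hE, ?_⟩
      simp only [IsDown, Prod.mk.injEq] at hcl hcr
      rcases hcl with ⟨rfl, rfl⟩ | ⟨rfl, rfl⟩
      · rcases hcr with ⟨-, rfl⟩ | ⟨-, rfl⟩
        · exact absurd rfl hla
        · exact Or.inl rfl
      · rcases hcr with ⟨-, rfl⟩ | ⟨-, rfl⟩
        · right; rw [h1]
        · exact absurd rfl hla
    · cases i with
      | zero =>
        exact absurd ((eq_gxx_of_mem_level_one hi).trans (eq_gxx_of_mem_level_one hj).symm) hlr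
      | succ i =>
        right
        simp only [GD, Set.mem_ofPred_eq]
        exact ⟨l, la, c, ra, r, rfl, hi, down_mem_level hi hcl, hj, hlr, hcl, hcr⟩

theorem mem_G5_iff {g : Symb} : g ∈ G5 ↔ Tuple g := by
  constructor
  · rintro ⟨i, -, h⟩
    exact tuple_of_mem_level i g h
  · intro h
    obtain ⟨i, hi⟩ := h.exists_level
    exact ⟨i + 1, by omega, hi⟩

theorem Tuple.height_down {g c : Symb} {a : Anchor} (h : Tuple g) (hc : IsDown g c a) :
    g.height = c.height + 1 := by
  obtain ⟨i, hi⟩ := h.exists_level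
  rw [height_of_mem_level _ _ hi, Symb.height_down hi hc]

theorem Tuple.down {g c : Symb} {a : Anchor} (h : Tuple g) (hc : IsDown g c a) :
    Tuple c ∨ c = one := by
  cases h with
  | gxx => exact Or.inr (down_gxx hc)
  | tup l la c ra r hl hr =>
    rcases hc with hc | hc <;> obtain ⟨rfl, -⟩ := Prod.mk.injEq .. ▸ hc
    · exact Or.inl hl
    · exact Or.inl hr

theorem not_tuple_anc (a : Anchor) : ¬ Tuple (anc a) := nofun

end Symb

/-! ### Letters, edges and rivers -/

namespace Gen

/-- The letter `1`. -/
abbrev one : Gen := anc .one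

theorem isTuple_iff {g : Gen} : g.IsTuple ↔ g.1.Tuple := Symb.mem_G5_iff

theorem not_isTuple_anc (a : Anchor) : ¬ (anc a).IsTuple := fun h =>
  Symb.not_tuple_anc a (isTuple_iff.1 h)

theorem isTuple_or (g : Gen) : g.IsTuple ∨ ∃ a, g = anc a := by
  rcases g with ⟨g, h | ⟨a, rfl⟩⟩
  · exact Or.inl h
  · exact Or.inr ⟨a, rfl⟩

theorem isTuple_gxx : gxx.IsTuple := isTuple_iff.2 .gxx

theorem anc_injective : Function.Injective anc := fun a b h => by
  simpa [anc] using h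

end Gen

/-- A letter, an anchor and a letter. -/
abbrev Edge : Type := Gen × Anchor × Gen

namespace Edge

/-- The first letter. -/
abbrev src (e : Edge) : Gen := e.1
/-- The anchor. -/
abbrev lab (e : Edge) : Anchor := e.2.1
/-- The second letter. -/
abbrev tgt (e : Edge) : Gen := e.2.2
/-- The reversed edge. -/
def inv (e : Edge) : Edge := (e.tgt, e.lab.inv, e.src)

theorem inv_inv (e : Edge) : e.inv.inv = e := by
  simp [inv, src, lab, tgt, Anchor.inv_inv]

/-- The edge goes up. -/
def Up (e : Edge) : Prop := LeftAnchored e.src e.lab e.tgt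
/-- The edge goes down. -/
def Down (e : Edge) : Prop := RightAnchored e.src e.lab e.tgt

theorem down_iff {e : Edge} : e.Down ↔ e.src.1.Tuple ∧ e.src.1.IsDown e.tgt.1 e.lab := by
  unfold Down RightAnchored Symb.IsDown
  rw [Gen.isTuple_iff]
  simp only [Prod.mk.injEq, Subtype.ext_iff, Gen.l, Gen.r, Gen.la, Gen.ra]

theorem up_iff {e : Edge} : e.Up ↔ e.inv.Down := by
  unfold Down RightAnchored Up LeftAnchored inv
  simp only [Prod.mk.injEq, Anchor.inv_injective.eq_iff]

theorem inv_up_iff {e : Edge} : e.inv.Up ↔ e.Down := by rw [up_iff, inv_inv]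

theorem Down.height {e : Edge} (h : e.Down) : e.src.height = e.tgt.height + 1 :=
  (down_iff.1 h).1.height_down (down_iff.1 h).2

theorem Up.height {e : Edge} (h : e.Up) : e.tgt.height = e.src.height + 1 :=
  (up_iff.1 h).height

/-- The heights of the two ends decide the direction. This is what keeps distinct rivers from
overlapping. -/
theorem Up.not_down {e : Edge} (h : e.Up) : ¬ e.Down := fun h' => by
  have := h.height
  have := h'.height
  omega

theorem Down.isVertex {e : Edge} (h : e.Down) : e.src.IsVertex ∧ e.tgt.IsVertex := by
  refine ⟨Or.inl h.1, ?_⟩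
  obtain ⟨h1, h2⟩ := down_iff.1 h
  rcases h1.down h2 with h | h
  · exact Or.inl (Gen.isTuple_iff.2 h)
  · exact Or.inr (Subtype.ext h)

theorem Up.isVertex {e : Edge} (h : e.Up) : e.src.IsVertex ∧ e.tgt.IsVertex :=
  (up_iff.1 h).isVertex.symm

end Edge

namespace Gen

theorem height_pos {g : Gen} (h : g.IsTuple) : 1 ≤ g.height := by
  obtain ⟨i, h1, h⟩ := h
  rw [height, Symb.height_of_mem_level _ _ h]
  exact h1

theorem eq_gxx {g : Gen} (h : g.IsTuple) (h1 : g.height = 1) : g = gxx := by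
  obtain ⟨i, -, h⟩ := h
  rw [height, Symb.height_of_mem_level _ _ h] at h1
  subst h1
  exact Subtype.ext (Symb.eq_gxx_of_mem_level_one h)

/-- The edge from `g` to `g^l`. -/
def eL (g : Gen) : Edge := (g, g.la.inv, g.l)
/-- The edge from `g` to `g^r`. -/
def eR (g : Gen) : Edge := (g, g.ra.inv, g.r)
/-- The edge from `g^l` to `g^c`. -/
def eLC (g : Gen) : Edge := (g.l, g.la, g.c)
/-- The edge from `g^r` to `g^c`. -/
def eRC (g : Gen) : Edge := (g.r, g.ra, g.c)

theorem eL_down {g : Gen} (h : g.IsTuple) : g.eL.Down := ⟨h, Or.inl rfl⟩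
theorem eR_down {g : Gen} (h : g.IsTuple) : g.eR.Down := ⟨h, Or.inr rfl⟩

theorem down_cases {e : Edge} (h : e.Down) : e.src.IsTuple ∧ (e = e.src.eL ∨ e = e.src.eR) := by
  refine ⟨h.1, ?_⟩
  rcases e with ⟨g, a, k⟩
  rcases h.2 with h | h <;> simp only [Prod.mk.injEq, Edge.src, Edge.lab, Edge.tgt] at h <;>
    obtain ⟨rfl, rfl⟩ := h
  · exact Or.inl rfl
  · exact Or.inr rfl

theorem ne_gxx_of_height {g : Gen} (h2 : 2 ≤ g.height) : g ≠ gxx := by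
  rintro rfl
  exact absurd h2 (by decide)

/-- These edges bound the river covered by `g`: it descends along `eRC` and ascends along the
reverse of `eLC`, and as the two differ it is not a cancellation. The height bound excludes
`g_{xx'}`, whose middle entry `x` is not a vertex. -/
theorem tuple_entries {g : Gen} (h : g.IsTuple) (h2 : 2 ≤ g.height) :
    g.eLC.Down ∧ g.eRC.Down ∧ g.eLC ≠ g.eRC := by
  obtain ⟨g, hg⟩ := g
  have ht := isTuple_iff.1 h
  cases ht with
  | gxx => exact absurd rfl (ne_gxx_of_height h2)
  | tup l la c ra r hl hr hcl hcr hne =>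
    refine ⟨Edge.down_iff.2 ⟨hl, hcl⟩, Edge.down_iff.2 ⟨hr, hcr⟩, fun e => hne ?_⟩
    simp only [eLC, eRC, Prod.mk.injEq, Subtype.ext_iff] at e
    exact Prod.ext e.1 e.2.1

theorem height_c {g : Gen} (h : g.IsTuple) (h2 : 2 ≤ g.height) : g.height = g.c.height + 2 := by
  have h3 := (eL_down h).height
  have h4 := (tuple_entries h h2).1.height
  simp only [eL, eLC, Edge.src, Edge.tgt] at h3 h4
  omega

theorem c_isVertex {g : Gen} (h : g.IsTuple) (h2 : 2 ≤ g.height) : g.c.IsVertex :=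
  (tuple_entries h h2).1.isVertex.2

open Classical in
/-- The symbol `s` as a letter, if it is one. -/
noncomputable def ofSymb (s : Symb) : Gen := if h : s ∈ Symb.G then ⟨s, h⟩ else one

theorem ofSymb_coe (g : Gen) : ofSymb g.1 = g := by
  simp [ofSymb, g.2]

end Gen

namespace Edge

/-- The letter by which a river is replaced. -/
noncomputable def peak (d u : Edge) : Gen :=
  Gen.ofSymb (.tup u.tgt.1 u.lab.inv u.src.1 d.lab d.src.1)

/-- The edges `d`, `u` form a river. -/
def River (d u : Edge) : Prop := d.Down ∧ u.Up ∧ d.tgt = u.src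

/-- The conditions on a tuple of height at least 2 say precisely that `d` and `u.inv` are two
different edges going down to the same letter. -/
theorem River.peak_val {d u : Edge} (h : River d u) (hne : d ≠ u.inv) :
    (peak d u).1 = .tup u.tgt.1 u.lab.inv u.src.1 d.lab d.src.1 ∧ (peak d u).IsTuple := by
  obtain ⟨hd, hu, e⟩ := h
  have ht : Symb.Tuple (.tup u.tgt.1 u.lab.inv u.src.1 d.lab d.src.1) := by
    obtain ⟨h1, h2⟩ := down_iff.1 hd
    obtain ⟨h3, h4⟩ := down_iff.1 (up_iff.1 hu)
    refine .tup _ _ _ _ _ h3 h1 h4 (e ▸ h2) fun e' => hne ?_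
    rcases d with ⟨d1, d2, d3⟩
    rcases u with ⟨u1, u2, u3⟩
    simp only [Prod.mk.injEq, Subtype.ext_iff, inv] at e' e ⊢
    exact ⟨e'.1.symm, e'.2.symm, e⟩
  have h5 : (peak d u).1 = .tup u.tgt.1 u.lab.inv u.src.1 d.lab d.src.1 := by
    have : Symb.tup u.tgt.1 u.lab.inv u.src.1 d.lab d.src.1 ∈ Symb.G :=
      Or.inl (Symb.mem_G5_iff.2 ht)
    unfold peak Gen.ofSymb
    rw [dif_pos this]
  exact ⟨h5, Gen.isTuple_iff.2 (h5 ▸ ht)⟩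

/-- The path by which a river is replaced. -/
noncomputable def lift (d u : Edge) : List Edge :=
  open Classical in
  if d = u.inv then [] else [(d.src, d.lab, peak d u), (peak d u, u.lab, u.tgt)]

theorem lift_inv (u : Edge) : lift u.inv u = [] := by simp [lift]

/-- The left entry of the peak is the letter on the right of the river. Therefore the new path
ascends along the reverse of `eR` and descends along `eL`. -/
theorem River.eq_of_ne {d u : Edge} (h : River d u) (hne : d ≠ u.inv) :
    (peak d u).eRC = d ∧ (peak d u).eLC.inv = u ∧ 2 ≤ (peak d u).height ∧
    (d.src, d.lab, peak d u) = (peak d u).eR.inv ∧ (peak d u, u.lab, u.tgt) = (peak d u).eL := by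
  obtain ⟨h1, h2⟩ := h.peak_val hne
  obtain ⟨hd, hu, e⟩ := h
  have hu' := hu.height
  generalize peak d u = k at *
  rcases d with ⟨d1, d2, d3⟩
  rcases u with ⟨u1, u2, u3⟩
  obtain ⟨k, hk⟩ := k
  simp only [src, lab, tgt] at h1 e
  subst h1
  subst e
  refine ⟨rfl, ?_, ?_, ?_, ?_⟩
  · simp [Gen.eLC, inv, src, lab, tgt, Gen.l, Gen.c, Gen.la, Symb.l, Symb.la, Symb.c, Anchor.inv_inv]
  · simp only [Gen.height, Symb.height, tgt] at hu' ⊢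
    omega
  · simp [Gen.eR, inv, src, lab, tgt, Gen.r, Gen.ra, Symb.r, Symb.ra, Anchor.inv_inv]
  · simp [Gen.eL, Gen.l, Gen.la, Symb.l, Symb.la, Anchor.inv_inv]

end Edge

/-- The river below a tuple is replaced by the tuple. -/
theorem Gen.lift_eq {g : Gen} (h : g.IsTuple) (h2 : 2 ≤ g.height) :
    Edge.River g.eRC g.eLC.inv ∧ Edge.lift g.eRC g.eLC.inv = [g.eR.inv, g.eL] := by
  obtain ⟨h3, h4, hne⟩ := tuple_entries h h2
  have hr : Edge.River g.eRC g.eLC.inv := ⟨h4, Edge.inv_up_iff.2 h3, rfl⟩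
  refine ⟨hr, ?_⟩
  have hne' : g.eRC ≠ g.eLC.inv.inv := by rw [Edge.inv_inv]; exact hne.symm
  have hk : Edge.peak g.eRC g.eLC.inv = g := by
    have := (hr.peak_val hne').1
    obtain ⟨g, hg⟩ := g
    have ht := isTuple_iff.1 h
    cases ht with
    | gxx => exact absurd rfl (ne_gxx_of_height h2)
    | tup l la c ra r hl hr hcl hcr hne =>
      apply Subtype.ext
      rw [this]
      simp [Gen.eLC, Gen.eRC, Edge.inv, Edge.src, Edge.lab, Edge.tgt, Gen.l, Gen.c, Gen.la, Symb.l, Symb.la, Symb.c,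
        Anchor.inv_inv, Gen.r, Symb.r, Gen.ra, Symb.ra]
  obtain ⟨-, -, -, h5, h6⟩ := hr.eq_of_ne hne'
  rw [Edge.lift, if_neg hne', h5, h6, hk]

/-! ### Uplifting as a confluent rewriting of paths -/

/-- Uplifting of a river in a sequence of edges. -/
inductive Step : List Edge → List Edge → Prop
  | river (d u : Edge) (t : List Edge) (h : Edge.River d u) :
      Step (d :: u :: t) (Edge.lift d u ++ t)
  | cons (e : Edge) (p q : List Edge) (h : Step p q) : Step (e :: p) (e :: q)

namespace Step

theorem append_right {p q : List Edge} (h : Step p q) (t : List Edge) : Step (p ++ t) (q ++ t) := by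
  induction h with
  | river d u s h => simpa using river d u (s ++ t) h
  | cons e p q _ ih => exact cons e _ _ ih

theorem append_left {p q : List Edge} (h : Step p q) (s : List Edge) : Step (s ++ p) (s ++ q) := by
  induction s with
  | nil => exact h
  | cons e s ih => exact cons e _ _ ih

theorem exists_eq {p q : List Edge} (h : Step p q) :
    ∃ s d u t, Edge.River d u ∧ p = s ++ d :: u :: t ∧ q = s ++ (Edge.lift d u ++ t) := by
  induction h with
  | river d u t h => exact ⟨[], d, u, t, h, rfl, rfl⟩
  | cons e p q _ ih =>
    obtain ⟨s, d, u, t, h, rfl, rfl⟩ := ih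
    exact ⟨e :: s, d, u, t, h, rfl, rfl⟩

/-- Two different rivers are disjoint blocks of edges, because a common edge would have to go both
up and down. Uplifting one leaves the other intact. -/
theorem diamond {p q r : List Edge} (h : Step p q) (h' : Step p r) :
    q = r ∨ ∃ s, Step q s ∧ Step r s := by
  induction h generalizing r with
  | river d u t h =>
    cases h' with
    | river _ _ _ _ => exact Or.inl rfl
    | cons _ _ q' h' =>
      cases h' with
      | river _ u' t' h' => exact absurd h'.1 h.2.1.not_down
      | cons _ _ q' h' => exact Or.inr ⟨_, h'.append_left _, river d u q' h⟩
  | cons e p q hs ih =>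
    cases h' with
    | river _ u t h =>
      cases hs with
      | river _ u' t' h' => exact absurd h'.1 h.2.1.not_down
      | cons _ _ q' h' => exact Or.inr ⟨_, river e u q' h, h'.append_left _⟩
    | cons _ _ q' h' =>
      rcases ih h' with rfl | ⟨s, h1, h2⟩
      · exact Or.inl rfl
      · exact Or.inr ⟨_, cons e _ _ h1, cons e _ _ h2⟩

end Step

/-- Sequences of edges are related if they differ by uplifting rivers. -/
def pathCon : Con (FreeMonoid Edge) where
  r p q := Relation.EqvGen Step p.toList q.toList
  iseqv := ⟨fun _ => .refl _, fun h => .symm _ _ h, fun h h' => .trans _ _ _ h h'⟩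
  mul' := by
    intro p q r s h h'
    simp only [FreeMonoid.toList_mul]
    generalize p.toList = p, q.toList = q, r.toList = r, s.toList = s at *
    refine .trans _ (q ++ r) _ ?_ ?_
    · induction h with
      | rel _ _ h => exact .rel _ _ (h.append_right _)
      | refl => exact .refl _
      | symm _ _ _ ih => exact .symm _ _ ih
      | trans _ _ _ _ _ ih ih' => exact .trans _ _ _ ih ih'
    · induction h' with
      | rel _ _ h => exact .rel _ _ (h.append_left _)
      | refl => exact .refl _
      | symm _ _ _ ih => exact .symm _ _ ih
      | trans _ _ _ _ _ ih ih' => exact .trans _ _ _ ih ih'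

/-- The class of a sequence of edges up to uplifting. -/
def pathCls (p : List Edge) : pathCon.Quotient :=
  ((FreeMonoid.ofList p : FreeMonoid Edge) : pathCon.Quotient)

theorem pathCls_append (p q : List Edge) : pathCls (p ++ q) = pathCls p * pathCls q := rfl

theorem pathCls_nil : pathCls [] = 1 := rfl

theorem pathCls_cons (e : Edge) (q : List Edge) : pathCls (e :: q) = pathCls [e] * pathCls q := rfl

theorem pathCls_eq_iff {p q : List Edge} : pathCls p = pathCls q ↔ Relation.EqvGen Step p q :=
  Con.eq _

theorem Step.pathCls_eq {p q : List Edge} (h : Step p q) : pathCls p = pathCls q :=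
  pathCls_eq_iff.2 (.rel _ _ h)

theorem reflTransGen_pathCls_eq {p q : List Edge} (h : Relation.ReflTransGen Step p q) :
    pathCls p = pathCls q := by
  induction h with
  | refl => rfl
  | tail _ h ih => exact ih.trans h.pathCls_eq

theorem exists_common_of_pathCls_eq {p q : List Edge} (h : pathCls p = pathCls q) :
    ∃ r, Relation.ReflTransGen Step p r ∧ Relation.ReflTransGen Step q r := by
  have hcr : ∀ a b c : List Edge, Step a b → Step a c →
      ∃ d, Relation.ReflGen Step b d ∧ Relation.ReflTransGen Step c d := by
    intro a b c h h'
    rcases h.diamond h' with rfl | ⟨s, h1, h2⟩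
    · exact ⟨b, .refl, .refl⟩
    · exact ⟨s, .single h1, .single h2⟩
  have heq := Relation.equivalence_join_reflTransGen hcr
  have := pathCls_eq_iff.1 h
  clear h
  change Relation.Join (Relation.ReflTransGen Step) p q
  induction this with
  | rel _ _ h => exact ⟨_, .single h, .refl⟩
  | refl => exact heq.refl _
  | symm _ _ _ ih => exact heq.symm ih
  | trans _ _ _ _ _ ih ih' => exact heq.trans ih ih'

theorem reflTransGen_eq_of_irreducible {p q : List Edge} (hp : ∀ r, ¬ Step p r)
    (h : Relation.ReflTransGen Step p q) : p = q := by
  rcases Relation.ReflTransGen.cases_head h with h | ⟨r, h, -⟩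
  · exact h
  · exact absurd h (hp r)

/-- Uniqueness of normal forms rests on confluence alone; termination plays no part. -/
theorem eq_of_pathCls_eq {p q : List Edge} (hp : ∀ r, ¬ Step p r) (hq : ∀ r, ¬ Step q r)
    (h : pathCls p = pathCls q) : p = q := by
  obtain ⟨r, h1, h2⟩ := exists_common_of_pathCls_eq h
  rw [reflTransGen_eq_of_irreducible hp h1, reflTransGen_eq_of_irreducible hq h2]

/-! ### Hills modulo uplifting -/

/-- The left hill of height `n` at `g`. -/
def upPath : ℕ → Gen → List Edge
  | 0, _ => []
  | 1, g => [(.one, .one, g)]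
  | n + 2, g => upPath n g.c ++ [g.eLC.inv, g.eL.inv]

/-- The right hill of height `n` at `g`. -/
def downPath : ℕ → Gen → List Edge
  | 0, _ => []
  | 1, g => [(g, .one, .one)]
  | n + 2, g => [g.eR, g.eRC] ++ downPath n g.c

/-- The edges of `β₁(g)`. -/
def letterPath (g : Gen) : List Edge :=
  match g.1 with
  | .anc .one => []
  | .anc .x => [(.one, .one, .gxx), (.gxx, .x, .one)]
  | .anc .xinv => [(.one, .xinv, .gxx), (.gxx, .one, .one)]
  | .tup _ _ _ _ _ => upPath g.height g ++ downPath g.height g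

/-- The class of the left hill. -/
def upCls (g : Gen) : pathCon.Quotient := pathCls (upPath g.height g)
/-- The class of the right hill. -/
def downCls (g : Gen) : pathCon.Quotient := pathCls (downPath g.height g)
/-- The class of `β₁(g)`. -/
def letterCls (g : Gen) : pathCon.Quotient := pathCls (letterPath g)

namespace Edge

/-- The class of an edge. -/
def cls (e : Edge) : pathCon.Quotient := pathCls [e]

theorem River.cls_mul {d u : Edge} (h : River d u) : d.cls * u.cls = pathCls (lift d u) := by
  have := (Step.river d u [] h).pathCls_eq
  rwa [List.append_nil] at this

/-- The cancellation is one-sided: `e.inv` followed by `e` is a summit, not a river, and does not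
reduce. -/
theorem Down.cls_mul_inv {e : Edge} (h : e.Down) : e.cls * e.inv.cls = 1 := by
  have h' : River e e.inv := ⟨h, inv_up_iff.2 h, rfl⟩
  rw [h'.cls_mul]
  have := lift_inv e.inv
  rw [inv_inv] at this
  rw [this]; rfl

end Edge

namespace Gen

theorem cls_eRC_mul {g : Gen} (h : g.IsTuple) (h2 : 2 ≤ g.height) :
    g.eRC.cls * g.eLC.inv.cls = g.eR.inv.cls * g.eL.cls := by
  obtain ⟨h3, h4⟩ := lift_eq h h2
  rw [h3.cls_mul, h4]; rfl

theorem upCls_one : upCls one = 1 := rfl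
theorem downCls_one : downCls one = 1 := rfl
theorem upCls_eq {g : Gen} (h : g.IsTuple) (h2 : 2 ≤ g.height) :
    upCls g = upCls g.c * (g.eLC.inv.cls * g.eL.inv.cls) := by
  unfold upCls
  rw [height_c h h2]; rfl

theorem downCls_eq {g : Gen} (h : g.IsTuple) (h2 : 2 ≤ g.height) :
    downCls g = g.eR.cls * (g.eRC.cls * downCls g.c) := by
  unfold downCls
  rw [height_c h h2]; rfl

theorem letterCls_eq {g : Gen} (h : g.IsVertex) : letterCls g = upCls g * downCls g := by
  rcases h with h | rfl
  · obtain ⟨g, hg⟩ := g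
    cases g with
    | anc a => exact absurd h (not_isTuple_anc a)
    | tup l la c ra r => rfl
  · rfl

/-- The valley between two hills at `g` fills up. By induction the part between the two copies of
`g.c` vanishes, the river left at `g.c` lifts to `g`, and the two remaining rivers cancel. -/
theorem downCls_mul_upCls {g : Gen} (hg : g.IsVertex) : downCls g * upCls g = 1 := by
  generalize hn : g.height = n
  induction n using Nat.strong_induction_on generalizing g with
  | _ n ih =>
  rcases hg with hg | rfl
  · by_cases h2 : 2 ≤ g.height
    · have hc := ih _ (by have := height_c hg h2; omega) (c_isVertex hg h2) rfl
      rw [upCls_eq hg h2, downCls_eq hg h2]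
      calc
        _ = g.eR.cls * (g.eRC.cls * (downCls g.c * upCls g.c) * g.eLC.inv.cls) * g.eL.inv.cls := by
              simp only [mul_assoc]
        _ = (g.eR.cls * g.eR.inv.cls) * (g.eL.cls * g.eL.inv.cls) := by
              rw [hc, mul_one, cls_eRC_mul hg h2]; simp only [mul_assoc]
        _ = 1 := by
              rw [(eR_down hg).cls_mul_inv, (eL_down hg).cls_mul_inv, one_mul]
    · have := height_pos hg
      -- Both hills of `g_{xx'}` use the edge with anchor `1`, that is `eL` and its reverse.
      rw [eq_gxx hg (by omega)]
      exact (eL_down isTuple_gxx).cls_mul_inv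
  · rfl

/-- Both directions are proved together, because the step for an edge below `g` needs the edges
`eLC` and `eRC` one level lower in both orientations. After the hills of `g` are unfolded, the
induction hypothesis turns the part around `g.c` into one edge. What remains either cancels or is
the river below `g`, which lifts to `g`. -/
theorem bridge_down {e : Edge} (he : e.Down) :
    downCls e.src * letterCls (anc e.lab) * upCls e.tgt = e.cls ∧
    downCls e.tgt * letterCls (anc e.lab.inv) * upCls e.src = e.inv.cls := by
  generalize hn : e.src.height = n
  induction n using Nat.strong_induction_on generalizing e with
  | _ n ih =>
  obtain ⟨hg, he'⟩ := down_cases he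
  generalize e.src = g at *
  by_cases h2 : 2 ≤ g.height
  · obtain ⟨h3, h4, -⟩ := tuple_entries hg h2
    obtain ⟨l1, l2⟩ := ih _ (by
      have := (eL_down hg).height
      simp only [eL, Edge.src, Edge.tgt] at this
      simp only [eLC, Edge.src]
      omega) h3 rfl
    obtain ⟨r1, r2⟩ := ih _ (by
      have := (eR_down hg).height
      simp only [eR, Edge.src, Edge.tgt] at this
      simp only [eRC, Edge.src]
      omega) h4 rfl
    change downCls g.l * letterCls (anc g.la) * upCls g.c = _ at l1
    change downCls g.c * letterCls (anc g.la.inv) * upCls g.l = _ at l2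
    change downCls g.r * letterCls (anc g.ra) * upCls g.c = _ at r1
    change downCls g.c * letterCls (anc g.ra.inv) * upCls g.r = _ at r2
    have hm := cls_eRC_mul hg h2
    have hL := (eL_down hg).cls_mul_inv
    have hR := (eR_down hg).cls_mul_inv
    rcases he' with rfl | rfl
    · change downCls g * letterCls (anc g.la.inv) * upCls g.l = _ ∧
        downCls g.l * letterCls (anc g.la.inv.inv) * upCls g = _
      rw [Anchor.inv_inv, upCls_eq hg h2, downCls_eq hg h2]
      constructor
      · calc _ = g.eR.cls * (g.eRC.cls * (downCls g.c * letterCls (anc g.la.inv) * upCls g.l)) := by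
                simp only [mul_assoc]
          _ = _ := by rw [l2, hm, ← mul_assoc, hR, one_mul]
      · rw [← mul_assoc, l1, ← mul_assoc, h3.cls_mul_inv, one_mul]
    · change downCls g * letterCls (anc g.ra.inv) * upCls g.r = _ ∧
        downCls g.r * letterCls (anc g.ra.inv.inv) * upCls g = _
      rw [Anchor.inv_inv, upCls_eq hg h2, downCls_eq hg h2]
      constructor
      · calc _ = g.eR.cls * (g.eRC.cls * (downCls g.c * letterCls (anc g.ra.inv) * upCls g.r)) := by
                simp only [mul_assoc]
          _ = _ := by rw [r2, h4.cls_mul_inv, mul_one]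
      · rw [← mul_assoc, r1, ← mul_assoc, hm, mul_assoc, hL, mul_one]
  · have := height_pos hg
    obtain rfl := eq_gxx hg (by omega)
    have hL := (eL_down hg).cls_mul_inv
    -- For `g_{xx'}` the path `β₁(1)` is empty and `β₁(x)` is the reverse of `eL` followed by `eR`,
    -- so only the edge `eR` needs a cancellation.
    rcases he' with rfl | rfl
    · exact ⟨rfl, rfl⟩
    · constructor
      · change gxx.eL.cls * (gxx.eL.inv.cls * gxx.eR.cls) * 1 = gxx.eR.cls
        rw [mul_one, ← mul_assoc, hL, one_mul]
      · change 1 * (gxx.eR.inv.cls * gxx.eL.cls) * gxx.eL.inv.cls = gxx.eR.inv.cls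
        rw [one_mul, mul_assoc, hL, mul_one]

end Gen

/-- The edge goes up or down. -/
def Edge.IsStep (e : Edge) : Prop := Anchored e.src e.lab e.tgt

theorem Edge.IsStep.bridge {e : Edge} (he : e.IsStep) :
    downCls e.src * letterCls (Gen.anc e.lab) * upCls e.tgt = e.cls := by
  rcases he with he | he
  · have := (Gen.bridge_down (Edge.up_iff.1 he)).2
    rw [Edge.inv_inv] at this
    rw [← this]
    simp only [Edge.inv, Edge.src, Edge.lab, Edge.tgt, Anchor.inv_inv]
  · exact (Gen.bridge_down he).1

/-! ### Paths and their end points -/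

/-- The sequence of edges leads from `g` to `h`. -/
def IsPath : Gen → List Edge → Gen → Prop
  | g, [], h => g = h
  | g, e :: p, h => e.src = g ∧ e.IsStep ∧ IsPath e.tgt p h

theorem isPath_append {g k : Gen} {p q : List Edge} :
    IsPath g (p ++ q) k ↔ ∃ h, IsPath g p h ∧ IsPath h q k := by
  induction p generalizing g with
  | nil => simp [IsPath]
  | cons e p ih => simp [IsPath, ih, and_assoc]

theorem Edge.River.isPath_lift {d u : Edge} (h : River d u) : IsPath d.src (lift d u) u.tgt := by
  unfold lift
  split
  · next e => rw [e]; rfl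
  · next e =>
    obtain ⟨h1, h2, h3, h4, h5⟩ := h.eq_of_ne e
    have ht := (h.peak_val e).2
    refine ⟨rfl, Or.inl ?_, rfl, Or.inr ?_, rfl⟩
    · change Edge.Up (d.src, d.lab, peak d u)
      rw [h4]; exact inv_up_iff.2 (Gen.eR_down ht)
    · change Edge.Down (peak d u, u.lab, u.tgt)
      rw [h5]; exact Gen.eL_down ht

theorem Step.isPath {p q : List Edge} (h : Step p q) {g k : Gen} (hp : IsPath g p k) :
    IsPath g q k := by
  induction h generalizing g with
  | river d u t h =>
    obtain ⟨rfl, -, -, -, h'⟩ := hp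
    exact isPath_append.2 ⟨_, h.isPath_lift, h'⟩
  | cons e p q _ ih => exact ⟨hp.1, hp.2.1, ih hp.2.2⟩

theorem reflTransGen_isPath {p q : List Edge} (h : Relation.ReflTransGen Step p q) {g k : Gen}
    (hp : IsPath g p k) : IsPath g q k := by
  induction h with
  | refl => exact hp
  | tail _ h ih => exact h.isPath ih

theorem Gen.isPath_upPath {g : Gen} (hg : g.IsVertex) : IsPath one (upPath g.height g) g := by
  generalize hn : g.height = n
  induction n using Nat.strong_induction_on generalizing g with
  | _ n ih =>
  rcases hg with hg | rfl
  · by_cases h2 : 2 ≤ g.height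
    · have h3 := height_c hg h2
      obtain rfl : n = g.c.height + 2 := by omega
      obtain ⟨h4, -⟩ := tuple_entries hg h2
      refine isPath_append.2 ⟨_, ih _ (by omega) (c_isVertex hg h2) rfl, ?_⟩
      exact ⟨rfl, Or.inl (Edge.inv_up_iff.2 h4), rfl, Or.inl (Edge.inv_up_iff.2 (eL_down hg)), rfl⟩
    · have := height_pos hg
      obtain rfl := eq_gxx hg (by omega)
      subst hn
      exact ⟨rfl, Or.inl (Edge.inv_up_iff.2 (eL_down hg)), rfl⟩
  · subst hn; rfl

theorem Gen.isPath_downPath {g : Gen} (hg : g.IsVertex) : IsPath g (downPath g.height g) one := by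
  generalize hn : g.height = n
  induction n using Nat.strong_induction_on generalizing g with
  | _ n ih =>
  rcases hg with hg | rfl
  · by_cases h2 : 2 ≤ g.height
    · have h3 := height_c hg h2
      obtain rfl : n = g.c.height + 2 := by omega
      obtain ⟨-, h4, -⟩ := tuple_entries hg h2
      exact ⟨rfl, Or.inr (eR_down hg), rfl, Or.inr h4, ih _ (by omega) (c_isVertex hg h2) rfl⟩
    · have := height_pos hg
      obtain rfl := eq_gxx hg (by omega)
      subst hn
      exact ⟨rfl, Or.inr (eL_down hg), rfl⟩
  · subst hn; rfl

theorem Gen.isPath_letterPath (g : Gen) : IsPath one (letterPath g) one := by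
  have hL := eL_down isTuple_gxx
  have hR := eR_down isTuple_gxx
  rcases g.isTuple_or with h | ⟨a, rfl⟩
  · have h' : letterPath g = upPath g.height g ++ downPath g.height g := by
      obtain ⟨g, hg⟩ := g
      cases g with
      | anc a => exact absurd h (not_isTuple_anc a)
      | tup l la c ra r => rfl
    rw [h']
    exact isPath_append.2 ⟨g, isPath_upPath (Or.inl h), isPath_downPath (Or.inl h)⟩
  · cases a
    · rfl
    · exact ⟨rfl, Or.inl (Edge.inv_up_iff.2 hL), rfl, Or.inr hR, rfl⟩
    · exact ⟨rfl, Or.inl (Edge.inv_up_iff.2 hR), rfl, Or.inr hL, rfl⟩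

/-! ### An explicit normal form -/

/-- Moving an edge (the first component, if present) leftwards over the edge `d`. -/
noncomputable def sweep (d : Edge) (s : Option Edge × List Edge) : Option Edge × List Edge :=
  open Classical in
  match s.1 with
  | none => (none, d :: s.2)
  | some c =>
    if Edge.River d c then
      if d = c.inv then (none, s.2)
      else (some (d.src, d.lab, Edge.peak d c), (Edge.peak d c, c.lab, c.tgt) :: s.2)
    else (none, d :: c :: s.2)

/-- Normal form of a mountain followed by an edge. -/
noncomputable def push (p : List Edge) (e : Edge) : List Edge :=
  let s := p.foldr sweep (some e, [])
  s.1.toList ++ s.2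

/-- Normal form of a sequence of edges. -/
noncomputable def normalize (p : List Edge) : List Edge := p.foldl push []

/-- Each move of the carried edge is at most one uplifting; when the edge is put down, nothing
changes. -/
theorem sweep_reduces (d : Edge) (s : Option Edge × List Edge) :
    Relation.ReflTransGen Step (d :: (s.1.toList ++ s.2))
      ((sweep d s).1.toList ++ (sweep d s).2) := by
  obtain ⟨c, out⟩ := s
  cases c with
  | none => exact .refl
  | some c =>
    simp only [sweep]
    by_cases h : Edge.River d c
    · have hs := Step.river d c out h
      rw [if_pos h]
      unfold Edge.lift at hs
      split_ifs at hs ⊢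
      · exact .single hs
      · exact .single hs
    · rw [if_neg h]; exact .refl

theorem foldr_sweep_reduces (p : List Edge) (e : Edge) :
    Relation.ReflTransGen Step (p ++ [e]) (push p e) := by
  induction p with
  | nil => exact .refl
  | cons d p ih =>
    refine .trans (b := d :: push p e) ?_ (sweep_reduces d _)
    exact ih.lift _ (fun _ _ h => Step.cons d _ _ h)

theorem normalize_reduces (p : List Edge) : Relation.ReflTransGen Step p (normalize p) := by
  induction p using List.reverseRecOn with
  | nil => exact .refl
  | append_singleton p e ih =>
    have h : normalize (p ++ [e]) = push (normalize p) e := by simp [normalize]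
    rw [h]
    exact (ih.lift (· ++ [e]) (fun _ _ h => h.append_right _)).trans (foldr_sweep_reduces _ e)

/-- The edges go up first and then down. -/
def UpDown (p : List Edge) : Prop :=
  ∃ us ds, p = us ++ ds ∧ (∀ e ∈ us, Edge.Up e) ∧ ∀ e ∈ ds, Edge.Down e

/-- Of any two edges in such a sequence, the earlier goes up or the later goes down. The two edges
of a river violate this. -/
theorem UpDown.irreducible {p : List Edge} (h : UpDown p) (q : List Edge) : ¬ Step p q := by
  obtain ⟨us, ds, rfl, hu, hd⟩ := h
  intro h
  obtain ⟨s, d, u, t, h, h', -⟩ := h.exists_eq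
  have h1 : (us ++ ds).Pairwise fun e f => e.Up ∨ f.Down := by
    rw [List.pairwise_append]
    refine ⟨?_, ?_, fun e he f _ => Or.inl (hu e he)⟩
    · exact List.pairwise_of_forall_mem_list fun e he f _ => Or.inl (hu e he)
    · exact List.pairwise_of_forall_mem_list fun e _ f hf => Or.inr (hd f hf)
  rw [h', List.pairwise_append] at h1
  rcases (List.pairwise_cons.1 h1.2.1).1 u (by simp) with h2 | h2
  · exact h2.not_down h.1
  · exact h.2.1.not_down h2

/-- The state after moving an edge over edges that go down. -/
theorem foldr_sweep_down {e : Edge} {ds : List Edge} (hd : ∀ d ∈ ds, Edge.Down d)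
    {g k : Gen} (hp : IsPath g (ds ++ [e]) k) :
    (∀ f ∈ (ds.foldr sweep (some e, [])).2, Edge.Down f) ∧
    ∀ c ∈ (ds.foldr sweep (some e, [])).1, c.IsStep := by
  induction ds generalizing g with
  | nil =>
    refine ⟨by simp, ?_⟩
    intro c hc
    simp only [List.foldr_nil, Option.mem_def, Option.some.injEq] at hc
    subst hc
    exact hp.2.1
  | cons d ds ih =>
    have ih := ih (fun f hf => hd f (List.mem_cons_of_mem _ hf)) hp.2.2
    -- Uplifting preserves paths, so a carried edge `c` starts where `d` ends. If `c` goes up, the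
    -- two therefore form a river; if not, `c` goes down and may be put down after `d`.
    have hpath : IsPath d.tgt (push ds e) k :=
      reflTransGen_isPath (foldr_sweep_reduces ds e) hp.2.2
    have hdd := hd d List.mem_cons_self
    unfold push at hpath
    rw [List.foldr_cons]
    generalize ds.foldr sweep (some e, []) = s at *
    obtain ⟨c, out⟩ := s
    simp only at ih hpath
    cases c with
    | none =>
      refine ⟨?_, by simp [sweep]⟩
      simp only [sweep, List.mem_cons]
      rintro f (rfl | hf)
      · exact hdd
      · exact ih.1 f hf
    | some c =>
      simp only [sweep]
      have hc := ih.2 c rfl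
      have hdc : c.src = d.tgt := hpath.1
      by_cases h : Edge.River d c
      · rw [if_pos h]
        by_cases hi : d = c.inv
        · rw [if_pos hi]
          exact ⟨ih.1, by simp⟩
        · rw [if_neg hi]
          have hl := h.isPath_lift
          obtain ⟨-, -, -, h4, h5⟩ := h.eq_of_ne hi
          have ht := (h.peak_val hi).2
          constructor
          · simp only [List.mem_cons]
            rintro f (rfl | hf)
            · rw [h5]; exact Gen.eL_down ht
            · exact ih.1 f hf
          · simp only [Option.mem_def, Option.some.injEq]
            rintro f rfl
            rw [h4]; exact Or.inl (Edge.inv_up_iff.2 (Gen.eR_down ht))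
      · rw [if_neg h]
        refine ⟨?_, by simp⟩
        simp only [List.mem_cons]
        rintro f (rfl | rfl | hf)
        · exact hdd
        · exact hc.resolve_left fun hu => h ⟨hdd, hu, hdc.symm⟩
        · exact ih.1 f hf

/-- An ascending edge cannot begin a river, so an edge carried up to it is put down there and the
rest is copied. -/
theorem foldr_sweep_up {us : List Edge} (hu : ∀ u ∈ us, Edge.Up u) (s : Option Edge × List Edge) :
    (us.foldr sweep s).1.toList ++ (us.foldr sweep s).2 = us ++ (s.1.toList ++ s.2) := by
  induction us with
  | nil => rfl
  | cons d us ih =>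
    have ih := ih fun f hf => hu f (List.mem_cons_of_mem _ hf)
    rw [List.foldr_cons, List.cons_append, ← ih]
    generalize us.foldr sweep s = s' at *
    obtain ⟨c, out⟩ := s'
    cases c with
    | none => rfl
    | some c =>
      have : ¬ Edge.River d c := fun h => (hu d List.mem_cons_self).not_down h.1
      simp [sweep, this]

/-- A descending `e` just prolongs the descent. An ascending `e` stays ascending while it moves
leftwards over the descent, leaving descending edges behind, until it is cancelled or joins the
ascent. -/
theorem UpDown.push {p : List Edge} (h : UpDown p) {e : Edge} {g k : Gen}
    (hp : IsPath g (p ++ [e]) k) : UpDown (push p e) := by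
  obtain ⟨us, ds, rfl, hu, hd⟩ := h
  rw [List.append_assoc] at hp
  obtain ⟨m, -, hp⟩ := isPath_append.1 hp
  obtain ⟨h1, h2⟩ := foldr_sweep_down hd hp
  have h3 := foldr_sweep_up hu (ds.foldr sweep (some e, []))
  rw [← List.foldr_append] at h3
  unfold FreeRegOne.push
  simp only
  rw [h3]
  generalize ds.foldr sweep (some e, []) = s at *
  obtain ⟨c, out⟩ := s
  cases c with
  | none => exact ⟨us, out, by simp, hu, h1⟩
  | some c =>
    rcases h2 c rfl with h | h
    · refine ⟨us ++ [c], out, by simp, ?_, h1⟩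
      simp only [List.mem_append, List.mem_singleton]
      rintro f (hf | rfl)
      · exact hu f hf
      · exact h
    · refine ⟨us, c :: out, by simp, hu, ?_⟩
      simp only [List.mem_cons]
      rintro f (rfl | hf)
      · exact h
      · exact h1 f hf

theorem normalize_upDown {p : List Edge} {g k : Gen} (hp : IsPath g p k) :
    UpDown (normalize p) := by
  induction p using List.reverseRecOn generalizing k with
  | nil => exact ⟨[], [], rfl, by simp, by simp⟩
  | append_singleton p e ih =>
    have h : normalize (p ++ [e]) = push (normalize p) e := by simp [normalize]
    rw [h]
    obtain ⟨m, h1, h2⟩ := isPath_append.1 hp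
    refine (ih h1).push (g := g) (k := k) (isPath_append.2 ⟨m, ?_, h2⟩)
    exact reflTransGen_isPath (normalize_reduces p) h1

theorem normalize_irreducible {p : List Edge} {g k : Gen} (hp : IsPath g p k) (q : List Edge) :
    ¬ Step (normalize p) q := (normalize_upDown hp).irreducible q

theorem pathCls_eq_iff_normalize {p q : List Edge} {g k g' k' : Gen} (hp : IsPath g p k)
    (hq : IsPath g' q k') : pathCls p = pathCls q ↔ normalize p = normalize q := by
  have h1 := reflTransGen_pathCls_eq (normalize_reduces p)
  have h2 := reflTransGen_pathCls_eq (normalize_reduces q)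
  constructor
  · intro h
    exact eq_of_pathCls_eq (normalize_irreducible hp) (normalize_irreducible hq)
      (h1.symm.trans (h.trans h2))
  · intro h
    rw [h1, h2, h]

/-! ### Translation between paths and landscapes -/

/-- The letters of a path after its first letter. -/
def pathLetters (p : List Edge) : List Gen := p.flatMap fun e => [Gen.anc e.lab, e.tgt]

/-- The word of a path that starts at `g`. -/
def toWord (g : Gen) (p : List Edge) : Word := ⟨g, pathLetters p⟩

theorem pathLetters_cons (e : Edge) (p : List Edge) :
    pathLetters (e :: p) = Gen.anc e.lab :: e.tgt :: pathLetters p := rfl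

theorem pathLetters_append (p q : List Edge) :
    pathLetters (p ++ q) = pathLetters p ++ pathLetters q := by
  simp [pathLetters]

theorem letters_toWord (g : Gen) (p : List Edge) : (toWord g p).letters = g :: pathLetters p := rfl

theorem toWord_cons (g : Gen) (e : Edge) (p : List Edge) :
    toWord g (e :: p) = Word.of g * Word.anc e.lab * toWord e.tgt p := rfl

theorem Word.letters_injective : Function.Injective Word.letters := by
  rintro ⟨a, s⟩ ⟨b, t⟩ h
  simp only [Word.letters, List.cons.injEq] at h
  rw [h.1, h.2]

theorem isLandscape_toWord {g k : Gen} {p : List Edge} (hg : g.IsVertex) (hp : IsPath g p k) :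
    IsLandscape (toWord g p) := by
  induction p generalizing g with
  | nil => exact .single g hg
  | cons e p ih =>
    obtain ⟨rfl, he, hp⟩ := hp
    have hv : e.tgt.IsVertex := he.elim (fun h => (Edge.Up.isVertex h).2)
      (fun h => (Edge.Down.isVertex h).2)
    exact .cons _ hg e.lab (toWord e.tgt p) he (ih hv hp)

theorem IsLandscape.exists_path {u : Word} (h : IsLandscape u) :
    u.head.IsVertex ∧ ∃ p k, IsPath u.head p k ∧ u = toWord u.head p := by
  induction h with
  | single g hg => exact ⟨hg, [], g, rfl, rfl⟩
  | cons g hg a w h _ ih =>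
    obtain ⟨-, p, k, h1, h2⟩ := ih
    refine ⟨hg, (g, a, w.head) :: p, k, ⟨rfl, h, h1⟩, ?_⟩
    conv_lhs => rw [h2]
    rfl

/-- Vertices occupy the even positions. The parity matters because the letter `1` is both a vertex
and an anchor. -/
theorem IsPath.exists_letters {g k : Gen} {p : List Edge} (hp : IsPath g p k) :
    ∃ P, g :: pathLetters p = P ++ [k] ∧ Even P.length := by
  induction p generalizing g with
  | nil => obtain rfl : g = k := hp; exact ⟨[], rfl, by simp⟩
  | cons e p ih =>
    obtain ⟨P, h1, h2⟩ := ih hp.2.2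
    refine ⟨g :: Gen.anc e.lab :: P, ?_, ?_⟩
    · rw [pathLetters_cons, h1]; rfl
    · simp only [List.length_cons]
      rw [Nat.even_add_one, Nat.even_add_one, not_not]
      exact h2

theorem IsPath.exists_river {g k : Gen} {p : List Edge} (hp : IsPath g p k) {P S : List Gen}
    {g₁ m g₂ : Gen} {a b : Anchor} (hP : Even P.length)
    (h : g :: pathLetters p = P ++ [g₁, Gen.anc a, m, Gen.anc b, g₂] ++ S) :
    ∃ s t, p = s ++ (g₁, a, m) :: (m, b, g₂) :: t ∧ P ++ [g₁] = g :: pathLetters s ∧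
      S = pathLetters t := by
  induction p generalizing g P with
  | nil =>
    have := congrArg List.length h
    simp [pathLetters] at this
    omega
  | cons e p ih =>
    rcases P with _ | ⟨x, _ | ⟨y, P⟩⟩
    · rw [pathLetters_cons] at h
      simp only [List.nil_append, List.cons_append, List.cons.injEq] at h
      obtain ⟨rfl, h1, h2, h3⟩ := h
      rcases e with ⟨e1, e2, e3⟩
      obtain rfl : e1 = g := hp.1
      obtain rfl : e2 = a := Gen.anc_injective h1
      obtain rfl : e3 = m := h2
      rcases p with _ | ⟨f, t⟩
      · simp [pathLetters] at h3
      · rw [pathLetters_cons] at h3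
        simp only [List.cons.injEq] at h3
        obtain ⟨h4, h5, h6⟩ := h3
        rcases f with ⟨f1, f2, f3⟩
        obtain rfl : f1 = e3 := hp.2.2.1
        obtain rfl : f2 = b := Gen.anc_injective h4
        obtain rfl : f3 = g₂ := h5
        exact ⟨[], t, rfl, rfl, h6.symm⟩
    -- A prefix of one letter would place the river at anchor positions; parity rules this out.
    · simp at hP
    · rw [pathLetters_cons] at h
      simp only [List.cons_append, List.cons.injEq] at h
      obtain ⟨rfl, rfl, h3⟩ := h
      have hP' : Even P.length := by
        simp only [List.length_cons] at hP
        rwa [Nat.even_add_one, Nat.even_add_one, not_not] at hP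
      obtain ⟨s, t, rfl, h4, h5⟩ := ih hp.2.2 hP' h3
      exact ⟨e :: s, t, rfl, by rw [pathLetters_cons, ← h4]; rfl, h5⟩

/-- Rivers of landscapes are defined by heights, rivers of paths by directions; an edge of the wrong
direction would change the height the wrong way. -/
theorem river_of_height {d u : Edge} (hd : d.IsStep) (hu : u.IsStep) (h : d.tgt = u.src)
    (h1 : d.src.height = d.tgt.height + 1) (h2 : u.tgt.height = u.src.height + 1) :
    Edge.River d u := by
  refine ⟨hd.resolve_left fun h' => ?_, hu.resolve_right fun h' => ?_, h⟩
  · have := Edge.Up.height h'; omega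
  · have := Edge.Down.height h'; omega

theorem IsPath.riverAt {g k : Gen} {p : List Edge} (hp : IsPath g p k) {P S : List Gen}
    {g₁ m g₂ : Gen} {a b : Anchor} (h : RiverAt (toWord g p) P g₁ a m b g₂ S) :
    ∃ s t, p = s ++ (g₁, a, m) :: (m, b, g₂) :: t ∧ P ++ [g₁] = g :: pathLetters s ∧
      S = pathLetters t ∧ Edge.River (g₁, a, m) (m, b, g₂) := by
  obtain ⟨h1, h2, h3, h4⟩ := h
  obtain ⟨s, t, rfl, h5, h6⟩ := hp.exists_river h2 h1
  refine ⟨s, t, rfl, h5, h6, ?_⟩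
  obtain ⟨n, -, -, hd, -, hu, -⟩ := isPath_append.1 hp
  exact river_of_height hd hu rfl h3 h4

theorem IsPath.step_of_hasRiver {g k : Gen} {p : List Edge} (hp : IsPath g p k)
    (h : HasRiver (toWord g p)) : ∃ q, Step p q := by
  obtain ⟨P, g₁, a, m, b, g₂, S, h⟩ := h
  obtain ⟨s, t, rfl, -, -, hr⟩ := hp.riverAt h
  exact ⟨_, (Step.river _ _ t hr).append_left s⟩

theorem IsPath.step_of_uplift {g k : Gen} {p : List Edge} (hp : IsPath g p k) {v : Word}
    (h : Uplift (toWord g p) v) : ∃ q, Step p q ∧ v = toWord g q := by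
  obtain ⟨-, P, g₁, a, m, b, g₂, S, h, hv⟩ := h
  obtain ⟨s, t, rfl, h1, rfl, hr⟩ := hp.riverAt h
  refine ⟨_, (Step.river _ _ t hr).append_left s, Word.letters_injective ?_⟩
  rw [letters_toWord, pathLetters_append, ← List.cons_append, ← h1]
  have hiff : (g₁, a, m) = Edge.inv (m, b, g₂) ↔ g₁ = g₂ ∧ a = b.inv := by
    simp [Edge.inv]
  rcases hv with ⟨he, hv⟩ | ⟨hne, k, hk, hv⟩
  · rw [hv, Edge.lift, if_pos (hiff.2 he)]; rfl
  · have hne' := mt hiff.1 hne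
    obtain rfl : k = Edge.peak (g₁, a, m) (m, b, g₂) := Subtype.ext (hk.trans (hr.peak_val hne').1.symm)
    rw [hv, Edge.lift, if_neg hne']
    simp [pathLetters]

theorem Step.uplift {p q : List Edge} (h : Step p q) {g k : Gen} (hg : g.IsVertex)
    (hp : IsPath g p k) : Uplift (toWord g p) (toWord g q) ∧ HasRiver (toWord g p) := by
  obtain ⟨s, d, u, t, hr, rfl, rfl⟩ := h.exists_eq
  clear h
  rename' hr => h
  obtain ⟨n, hs, rfl, -, -, -, -⟩ := isPath_append.1 hp
  obtain ⟨P, h1, h2⟩ := hs.exists_letters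
  have hd := h.1.height
  have hu := h.2.1.height
  have hr : RiverAt (toWord g (s ++ d :: u :: t)) P d.src d.lab u.src u.lab u.tgt
      (pathLetters t) := by
    refine ⟨?_, h2, h.2.2 ▸ hd, hu⟩
    rw [letters_toWord, pathLetters_append, ← List.cons_append, h1, ← h.2.2]
    simp [pathLetters]
  refine ⟨⟨isLandscape_toWord hg hp, P, _, _, _, _, _, _, hr, ?_⟩, ⟨P, _, _, _, _, _, _, hr⟩⟩
  have hiff : d = u.inv ↔ d.src = u.tgt ∧ d.lab = u.lab.inv := by
    have := h.2.2
    rcases d with ⟨d1, d2, d3⟩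
    simp only [Edge.inv, Prod.mk.injEq]
    tauto
  rw [letters_toWord, pathLetters_append, ← List.cons_append, h1]
  by_cases he : d = u.inv
  · exact Or.inl ⟨hiff.1 he, by rw [Edge.lift, if_pos he]; rfl⟩
  · refine Or.inr ⟨mt hiff.2 he, Edge.peak d u, (h.peak_val he).1, ?_⟩
    rw [Edge.lift, if_neg he]
    simp [pathLetters]

theorem reflTransGen_uplift {p q : List Edge} (h : Relation.ReflTransGen Step p q) {g k : Gen}
    (hg : g.IsVertex) (hp : IsPath g p k) :
    Relation.ReflTransGen Uplift (toWord g p) (toWord g q) := by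
  induction h with
  | refl => exact .refl
  | tail h1 h2 ih => exact ih.tail (h2.uplift hg (reflTransGen_isPath h1 hp)).1

theorem IsPath.reflTransGen_step {g k : Gen} {p : List Edge} (hp : IsPath g p k) {v : Word}
    (h : Relation.ReflTransGen Uplift (toWord g p) v) :
    ∃ q, Relation.ReflTransGen Step p q ∧ v = toWord g q := by
  induction h with
  | refl => exact ⟨p, .refl, rfl⟩
  | tail _ h2 ih =>
    obtain ⟨q, h3, rfl⟩ := ih
    obtain ⟨r, h4, rfl⟩ := (reflTransGen_isPath h3 hp).step_of_uplift h2
    exact ⟨r, h3.tail h4, rfl⟩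

theorem IsPath.hasRiver_iff {g k : Gen} {p : List Edge} (hg : g.IsVertex) (hp : IsPath g p k) :
    HasRiver (toWord g p) ↔ ∃ q, Step p q :=
  ⟨hp.step_of_hasRiver, fun ⟨_, h⟩ => (h.uplift hg hp).2⟩

/-! ### The map `β₁` in terms of paths -/

/-- The edges of `β₁(u)`. -/
def betaPath (u : Word) : List Edge := u.letters.flatMap letterPath

theorem betaPath_mul (u v : Word) : betaPath (u * v) = betaPath u ++ betaPath v := by
  change List.flatMap letterPath ((u.head :: u.tail) ++ (v.head :: v.tail)) = _
  rw [List.flatMap_append]; rfl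

theorem betaPath_of (g : Gen) : betaPath (Word.of g) = letterPath g := by
  change List.flatMap letterPath [g] = _
  simp

theorem isPath_flatMap_letterPath (w : List Gen) : IsPath .one (w.flatMap letterPath) .one := by
  induction w with
  | nil => rfl
  | cons g w ih => exact isPath_append.2 ⟨_, g.isPath_letterPath, ih⟩

theorem isPath_betaPath (u : Word) : IsPath .one (betaPath u) .one := isPath_flatMap_letterPath _

theorem Gen.inv_inv_la (g : Gen) : g.eL.inv = (g.l, g.la, g) := by
  simp [eL, Edge.inv, Edge.lab, Edge.src, Edge.tgt, Anchor.inv_inv]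

theorem hillL_eq {g : Gen} (hg : g.IsVertex) : hillL g.height g = toWord .one (upPath g.height g) := by
  generalize hn : g.height = n
  induction n using Nat.strong_induction_on generalizing g with
  | _ n ih =>
  rcases hg with hg | rfl
  · by_cases h2 : 2 ≤ g.height
    · have h3 := Gen.height_c hg h2
      obtain rfl : n = g.c.height + 2 := by omega
      have ih := ih _ (by omega) (Gen.c_isVertex hg h2) rfl
      rw [hillL, ih]
      apply Word.letters_injective
      rw [letters_toWord, upPath, pathLetters_append, Gen.inv_inv_la]
      simp only [toWord, Word.anc, Word.of, FreeSemigroup.of, Word.letters, FreeSemigroup.tail_mul,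
        FreeSemigroup.head_mul, List.append_assoc]
      rfl
    · have := Gen.height_pos hg
      obtain rfl : n = 1 := by omega
      rfl
  · subst hn; rfl

theorem hillR_eq {g : Gen} (hg : g.IsVertex) : hillR g.height g = toWord g (downPath g.height g) := by
  generalize hn : g.height = n
  induction n using Nat.strong_induction_on generalizing g with
  | _ n ih =>
  rcases hg with hg | rfl
  · by_cases h2 : 2 ≤ g.height
    · have h3 := Gen.height_c hg h2
      obtain rfl : n = g.c.height + 2 := by omega
      have ih := ih _ (by omega) (Gen.c_isVertex hg h2) rfl
      rw [hillR, ih]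
      rfl
    · have := Gen.height_pos hg
      obtain rfl : n = 1 := by omega
      rfl
  · subst hn; rfl

theorem star_toWord (g k : Gen) (p q : List Edge) :
    (toWord g p).star (toWord k q) = toWord g (p ++ q) := by
  apply Word.letters_injective
  rw [letters_toWord, pathLetters_append]
  rfl

theorem letterPath_of_isTuple {g : Gen} (h : g.IsTuple) :
    letterPath g = upPath g.height g ++ downPath g.height g := by
  obtain ⟨g, hg⟩ := g
  cases g with
  | anc a => exact absurd h (Gen.not_isTuple_anc a)
  | tup l la c ra r => rfl

theorem beta1Letter_eq (g : Gen) : beta1Letter g = toWord .one (letterPath g) := by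
  rcases g.isTuple_or with h | ⟨a, rfl⟩
  · have h' : beta1Letter g = (hillL g.height g).star (hillR g.height g) := by
      obtain ⟨g, hg⟩ := g
      cases g with
      | anc a => exact absurd h (Gen.not_isTuple_anc a)
      | tup l la c ra r => rfl
    rw [h', hillL_eq (Or.inl h), hillR_eq (Or.inl h), star_toWord, letterPath_of_isTuple h]
  · cases a <;> rfl

theorem beta1_eq (u : Word) : beta1 u = toWord .one (betaPath u) := by
  obtain ⟨g, w⟩ := u
  have key : ∀ (w : List Gen) (p : List Edge),
      w.foldl (fun w g => w.star (beta1Letter g)) (toWord .one p) =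
        toWord .one (p ++ w.flatMap letterPath) := by
    intro w
    induction w with
    | nil => intro p; simp
    | cons k w ih =>
      intro p
      rw [List.foldl_cons, beta1Letter_eq, star_toWord, ih]
      simp
  change w.foldl (fun w g => w.star (beta1Letter g)) (beta1Letter g) = _
  rw [beta1Letter_eq, key]; rfl

/-! ### Uplifting preserves `ρ`-classes, and `β₁(u)` represents `[u]` -/

theorem cls_mul (u v : Word) : cls (u * v) = cls u * cls v := rfl

theorem cls_eq_of_relE {u v : Word} (h : RelE u v) : cls u = cls v :=
  (Con.eq _).2 (ConGen.Rel.of _ _ (Or.inl h))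

theorem cls_eq_of_relS {u v : Word} (h : RelS u v) : cls u = cls v :=
  (Con.eq _).2 (ConGen.Rel.of _ _ (Or.inr h))

namespace Gen

theorem cls_idem {g : Gen} (h : g.IsVertex) :
    FreeRegOne.cls (Word.of g) * FreeRegOne.cls (Word.of g) = FreeRegOne.cls (Word.of g) :=
  cls_eq_of_relE (.idem g h)

end Gen

/-- A vertex is a left identity on the paths that start there. -/
theorem cls_of_mul_toWord {g : Gen} (h : g.IsVertex) (p : List Edge) :
    cls (Word.of g) * cls (toWord g p) = cls (toWord g p) := by
  cases p with
  | nil => exact g.cls_idem h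
  | cons e p =>
    rw [toWord_cons, cls_mul, cls_mul, ← mul_assoc, ← mul_assoc, Gen.cls_idem h]

/-- The two sides are coupled. The relation `right` gives `g g^c = g`, which turns `left` into `g
g^L g = g`; symmetrically `left` gives `g^c g = g`, which turns `right` into `g g^R g = g`. At
`g_{xx'}` the claim comes from `xx'x = x`. -/
theorem Edge.Down.cls_cancel {e : Edge} (h : e.Down) :
    FreeRegOne.cls (Word.of e.src * Word.anc e.lab * Word.of e.tgt * Word.anc e.lab.inv *
      Word.of e.src) = FreeRegOne.cls (Word.of e.src) := by
  obtain ⟨hg, he⟩ := Gen.down_cases h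
  generalize e.src = g at *
  have hi := g.cls_idem (Or.inl hg)
  by_cases h2 : 2 ≤ g.height
  · have hc := g.c.cls_idem (Gen.c_isVertex hg h2)
    have hl := cls_eq_of_relS (.left g hg h2)
    have hr := cls_eq_of_relS (.right g hg h2)
    rcases he with rfl | rfl
    · have hgc : FreeRegOne.cls (Word.of g) * FreeRegOne.cls (Word.of g.c) =
          FreeRegOne.cls (Word.of g) := by
        rw [← hr, cls_mul, mul_assoc, hc]
      have e1 : FreeRegOne.cls (Word.of g) * FreeRegOne.cls (wordL g) *
          FreeRegOne.cls (Word.of g) = FreeRegOne.cls (Word.of g) := by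
        rw [cls_mul, cls_mul] at hl
        calc _ = FreeRegOne.cls (Word.of g) * FreeRegOne.cls (Word.of g.c) *
              FreeRegOne.cls (wordL g) * FreeRegOne.cls (Word.of g) := by rw [hgc]
          _ = FreeRegOne.cls (Word.of g) * (FreeRegOne.cls (Word.of g.c) *
              FreeRegOne.cls (wordL g) * FreeRegOne.cls (Word.of g)) := by simp only [mul_assoc]
          _ = _ := by rw [hl, hi]
      rw [← cls_mul, ← cls_mul] at e1
      refine Eq.trans ?_ e1
      simp only [Gen.eL, wordL, mul_assoc, Anchor.inv_inv, Edge.tgt, Edge.lab]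
    · have hcg : FreeRegOne.cls (Word.of g.c) * FreeRegOne.cls (Word.of g) =
          FreeRegOne.cls (Word.of g) := by
        rw [← hl, cls_mul, cls_mul, ← mul_assoc, ← mul_assoc, hc]
      have e1 : FreeRegOne.cls (Word.of g) * FreeRegOne.cls (wordR g) *
          FreeRegOne.cls (Word.of g) = FreeRegOne.cls (Word.of g) := by
        conv_lhs => rw [← hcg, ← mul_assoc]
        rw [hcg, ← cls_mul, ← cls_mul, hr, hi]
      rw [← cls_mul, ← cls_mul] at e1
      refine Eq.trans ?_ e1
      simp only [Gen.eR, wordR, mul_assoc, Anchor.inv_inv, Edge.tgt, Edge.lab]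
  · have := Gen.height_pos hg
    obtain rfl := Gen.eq_gxx hg (by omega)
    have h1 (k : Gen) : FreeRegOne.cls (Word.of k) * FreeRegOne.cls (Word.anc .one) =
        FreeRegOne.cls (Word.of k) := cls_eq_of_relE (.mul_one k)
    have hx := cls_eq_of_relE .x_reg
    have hg := cls_eq_of_relE .gxx_eq
    rw [cls_mul] at hg
    rw [cls_mul, cls_mul] at hx
    simp only [cls_mul]
    rcases he with rfl | rfl
    · change FreeRegOne.cls (Word.of Gen.gxx) * FreeRegOne.cls (Word.anc .one) *
        FreeRegOne.cls (Word.anc .one) * FreeRegOne.cls (Word.anc .one) * _ = _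
      rw [h1, h1, h1, hi]
    · change FreeRegOne.cls (Word.of Gen.gxx) * FreeRegOne.cls (Word.anc .x) *
        FreeRegOne.cls (Word.anc .one) * FreeRegOne.cls (Word.anc .xinv) * _ = _
      rw [mul_assoc (FreeRegOne.cls (Word.of Gen.gxx)) (FreeRegOne.cls (Word.anc .x))]
      rw [show FreeRegOne.cls (Word.anc .x) * FreeRegOne.cls (Word.anc .one) =
        FreeRegOne.cls (Word.anc .x) from h1 _, hg, hx, ← hg, hi]

theorem Step.cls_eq {p q : List Edge} (h : Step p q) {g k : Gen} (hp : IsPath g p k) :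
    cls (toWord g p) = cls (toWord g q) := by
  induction h generalizing g with
  | river d u t h =>
    obtain ⟨rfl, -, -, -, -⟩ := hp
    have hv := h.2.1.isVertex.2
    have e0 : cls (toWord d.src (d :: u :: t)) = cls (Word.of d.src * Word.anc d.lab * Word.of d.tgt *
        Word.anc u.lab * Word.of u.tgt) * cls (toWord u.tgt t) := by
      rw [cls_mul _ (Word.of u.tgt), mul_assoc, cls_of_mul_toWord hv, toWord_cons, toWord_cons]
      simp only [cls_mul, mul_assoc]
    rw [e0]
    by_cases he : d = u.inv
    · subst he
      rw [Edge.lift_inv]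
      have := (Edge.up_iff.1 h.2.1).cls_cancel
      simp only [Edge.inv, Edge.src, Edge.lab, Edge.tgt, Anchor.inv_inv] at this
      simp only [Edge.inv, Edge.src, Edge.lab, Edge.tgt]
      rw [this]
      exact cls_of_mul_toWord hv t
    · obtain ⟨h1, h2, h3, h4, h5⟩ := h.eq_of_ne he
      -- The two sides of `middle` for the peak are the river and its uplifting.
      have hm := cls_eq_of_relS (.middle _ (h.peak_val he).2 h3)
      rw [Edge.lift, if_neg he]
      generalize Edge.peak d u = m at *
      subst h1 h2
      have e1 : cls (toWord m.eRC.src ([(m.eRC.src, m.eRC.lab, m), (m, m.eLC.inv.lab, m.eLC.inv.tgt)] ++ t)) =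
          cls (Word.of m.eRC.src * Word.anc m.eRC.lab * Word.of m *
        Word.anc m.eLC.inv.lab * Word.of m.eLC.inv.tgt) * cls (toWord m.eLC.inv.tgt t) := by
        rw [cls_mul _ (Word.of m.eLC.inv.tgt), mul_assoc, cls_of_mul_toWord hv, List.cons_append,
          toWord_cons, List.cons_append, toWord_cons]
        simp only [cls_mul, mul_assoc, List.nil_append]
      rw [e1]
      exact congrArg (· * _) hm.symm
  | cons e p q _ ih =>
    simp only [toWord_cons, cls_mul, ih hp.2.2]

theorem cls_eq_of_reflTransGen {p q : List Edge} (h : Relation.ReflTransGen Step p q) {g k : Gen}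
    (hp : IsPath g p k) : cls (toWord g p) = cls (toWord g q) := by
  induction h with
  | refl => rfl
  | tail h1 h2 ih => exact ih.trans (h2.cls_eq (reflTransGen_isPath h1 hp))

theorem cls_anc_one_mul (u : Word) : cls (Word.anc .one) * cls u = cls u := by
  have h1 (k : Gen) : cls (Word.anc .one) * cls (Word.of k) = cls (Word.of k) :=
    cls_eq_of_relE (.one_mul k)
  induction u using FreeSemigroup.recOnMul with
  | ih1 k => exact h1 k
  | ih2 k u h _ => rw [cls_mul, ← mul_assoc, h]

theorem cls_mul_anc_one (u : Word) : cls u * cls (Word.anc .one) = cls u := by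
  have h1 (k : Gen) : cls (Word.of k) * cls (Word.anc .one) = cls (Word.of k) :=
    cls_eq_of_relE (.mul_one k)
  induction u using FreeSemigroup.recOnMul with
  | ih1 k => exact h1 k
  | ih2 k u _ h => rw [cls_mul, mul_assoc, h]

theorem anc_one_mul (z : FOneOne) : cls (Word.anc .one) * z = z :=
  Con.induction_on z cls_anc_one_mul

theorem mul_anc_one (z : FOneOne) : z * cls (Word.anc .one) = z :=
  Con.induction_on z cls_mul_anc_one

/-- The product on the right contains the letter `h` twice; idempotency of vertices absorbs one
copy. -/
theorem cls_toWord_append {g h k : Gen} (hh : h.IsVertex) {p q : List Edge} (hp : IsPath g p h)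
    (hq : IsPath h q k) : cls (toWord g (p ++ q)) = cls (toWord g p) * cls (toWord h q) := by
  induction p generalizing g with
  | nil =>
    obtain rfl : g = h := hp
    exact (cls_of_mul_toWord hh q).symm
  | cons e p ih =>
    simp only [List.cons_append, toWord_cons, cls_mul, ih hp.2.2, mul_assoc]

/-- By induction the hill up to `g.c` evaluates to `g.c`, and the last two edges turn this into `g^c
g^L g`, which is `g` by the relation `left`. -/
theorem cls_upPath {g : Gen} (hg : g.IsVertex) :
    cls (toWord .one (upPath g.height g)) = cls (Word.of g) := by
  generalize hn : g.height = n
  induction n using Nat.strong_induction_on generalizing g with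
  | _ n ih =>
  rcases hg with hg | rfl
  · by_cases h2 : 2 ≤ g.height
    · have h3 := Gen.height_c hg h2
      obtain rfl : n = g.c.height + 2 := by omega
      have hc := Gen.c_isVertex hg h2
      have ih := ih _ (by omega) hc rfl
      have h4 := Gen.isPath_upPath hc
      have h5 : IsPath g.c [g.eLC.inv, g.eL.inv] g :=
        ⟨rfl, Or.inl (Edge.inv_up_iff.2 (Gen.tuple_entries hg h2).1), rfl,
          Or.inl (Edge.inv_up_iff.2 (Gen.eL_down hg)), rfl⟩
      rw [upPath, cls_toWord_append hc h4 h5, ih, ← cls_eq_of_relS (.left g hg h2)]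
      rw [Gen.inv_inv_la, toWord_cons, toWord_cons]
      change _ * cls (Word.of g.c * Word.anc g.la.inv * (Word.of g.l * Word.anc g.la * Word.of g)) = _
      simp only [wordL, cls_mul, ← mul_assoc, g.c.cls_idem hc]
    · have := Gen.height_pos hg
      obtain rfl : n = 1 := by omega
      change cls (Word.anc .one * Word.anc .one * Word.of g) = _
      rw [cls_mul, cls_mul, cls_anc_one_mul, cls_anc_one_mul]
  · subst hn; rfl

theorem cls_downPath {g : Gen} (hg : g.IsVertex) :
    cls (toWord g (downPath g.height g)) = cls (Word.of g) := by
  generalize hn : g.height = n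
  induction n using Nat.strong_induction_on generalizing g with
  | _ n ih =>
  rcases hg with hg | rfl
  · by_cases h2 : 2 ≤ g.height
    · have h3 := Gen.height_c hg h2
      obtain rfl : n = g.c.height + 2 := by omega
      have hc := Gen.c_isVertex hg h2
      have ih := ih _ (by omega) hc rfl
      rw [downPath, List.cons_append, toWord_cons, List.cons_append, toWord_cons, List.nil_append,
        cls_mul, cls_mul (_ * _) (toWord _ _)]
      change _ * (_ * cls (toWord g.c _)) = _
      rw [ih]
      conv_rhs => rw [← cls_eq_of_relS (.right g hg h2)]
      simp only [wordR, cls_mul, mul_assoc]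
      rfl
    · have := Gen.height_pos hg
      obtain rfl : n = 1 := by omega
      change cls (Word.of g * Word.anc .one * Word.anc .one) = _
      rw [cls_mul, cls_mul, cls_mul_anc_one, cls_mul_anc_one]
  · subst hn; rfl

theorem cls_letterPath (g : Gen) : cls (toWord .one (letterPath g)) = cls (Word.of g) := by
  rcases g.isTuple_or with h | ⟨a, rfl⟩
  · have hv : g.IsVertex := Or.inl h
    rw [letterPath_of_isTuple h, cls_toWord_append hv (Gen.isPath_upPath hv)
      (Gen.isPath_downPath hv), cls_upPath hv, cls_downPath hv, Gen.cls_idem hv]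
  · have hg := cls_eq_of_relE .gxx_eq
    cases a
    · rfl
    · have h : toWord .one (letterPath (.anc .x)) = Word.anc .one * Word.anc .one *
          Word.of .gxx * Word.anc .x * Word.anc .one := rfl
      rw [h]
      rw [cls_mul] at hg
      simp only [cls_mul, anc_one_mul, mul_anc_one, hg]
      exact cls_eq_of_relE .x_reg
    · have h : toWord .one (letterPath (.anc .xinv)) = Word.anc .one * Word.anc .xinv *
          Word.of .gxx * Word.anc .one * Word.anc .one := rfl
      rw [h]
      rw [cls_mul] at hg
      simp only [cls_mul, anc_one_mul, mul_anc_one, hg, ← mul_assoc]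
      exact cls_eq_of_relE .xinv_reg

theorem cls_betaPath (u : Word) : cls (toWord .one (betaPath u)) = cls u := by
  have hv : Gen.one.IsVertex := Or.inr rfl
  induction u using FreeSemigroup.recOnMul with
  | ih1 k =>
    change cls (toWord .one (betaPath (Word.of k))) = cls (Word.of k)
    rw [betaPath_of, cls_letterPath]
  | ih2 k u h1 h2 =>
    rw [betaPath_mul, cls_toWord_append hv (isPath_betaPath _) (isPath_betaPath _), h1, h2, cls_mul]

/-! ### Invariance of `β₁` under the relations -/

/-- Words with homotopic `β₁`. -/
def betaCon : Con Word where
  r u v := pathCls (betaPath u) = pathCls (betaPath v)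
  iseqv := ⟨fun _ => rfl, fun h => h.symm, fun h h' => h.trans h'⟩
  mul' := by
    intro u v w z h h'
    rw [betaPath_mul, betaPath_mul, pathCls_append, pathCls_append, h, h']

theorem pathCls_betaPath_mul (u v : Word) :
    pathCls (betaPath (u * v)) = pathCls (betaPath u) * pathCls (betaPath v) := by
  rw [betaPath_mul, pathCls_append]

theorem pathCls_betaPath_of (g : Gen) : pathCls (betaPath (Word.of g)) = letterCls g := by
  rw [betaPath_of]; rfl

theorem pathCls_betaPath_anc (a : Anchor) :
    pathCls (betaPath (Word.anc a)) = letterCls (.anc a) := pathCls_betaPath_of _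

theorem letterCls_anc_one : letterCls (.anc .one) = 1 := rfl
theorem letterCls_anc_x : letterCls (.anc .x) = Gen.gxx.eL.inv.cls * Gen.gxx.eR.cls := rfl
theorem letterCls_anc_xinv : letterCls (.anc .xinv) = Gen.gxx.eR.inv.cls * Gen.gxx.eL.cls := rfl

theorem pathCls_eq_of_relE {u v : Word} (h : RelE u v) :
    pathCls (betaPath u) = pathCls (betaPath v) := by
  have hL := (Gen.eL_down Gen.isTuple_gxx).cls_mul_inv
  have hR := (Gen.eR_down Gen.isTuple_gxx).cls_mul_inv
  have hL' (z) : Gen.gxx.eL.cls * (Gen.gxx.eL.inv.cls * z) = z := by rw [← mul_assoc, hL, one_mul]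
  have hR' (z) : Gen.gxx.eR.cls * (Gen.gxx.eR.inv.cls * z) = z := by rw [← mul_assoc, hR, one_mul]
  cases h with
  | x_reg | xinv_reg =>
    simp only [pathCls_betaPath_mul, pathCls_betaPath_anc, letterCls_anc_x, letterCls_anc_xinv,
      mul_assoc, hL', hR']
  | gxx_eq =>
    simp only [pathCls_betaPath_mul, pathCls_betaPath_anc, letterCls_anc_x, letterCls_anc_xinv,
      mul_assoc, hR', pathCls_betaPath_of, Gen.letterCls_eq (Or.inl Gen.isTuple_gxx)]
    rfl
  | one_mul g => rw [pathCls_betaPath_mul, pathCls_betaPath_anc, letterCls_anc_one, one_mul]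
  | mul_one g => rw [pathCls_betaPath_mul, pathCls_betaPath_anc, letterCls_anc_one, mul_one]
  | idem g hg =>
    rw [pathCls_betaPath_mul, pathCls_betaPath_of, Gen.letterCls_eq hg, mul_assoc,
      ← mul_assoc (downCls g), Gen.downCls_mul_upCls hg, one_mul]

/-- The product telescopes: between consecutive vertices, the right hill of the first, the anchor
and the left hill of the second contract to one edge by `Edge.IsStep.bridge`. Only the outermost
hills survive. -/
theorem pathCls_betaPath_toWord {g k : Gen} {p : List Edge} (hg : g.IsVertex)
    (hp : IsPath g p k) : pathCls (betaPath (toWord g p)) = upCls g * pathCls p * downCls k := by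
  induction p generalizing g with
  | nil =>
    obtain rfl : g = k := hp
    rw [pathCls_nil, mul_one, ← Gen.letterCls_eq hg]
    exact pathCls_betaPath_of g
  | cons e p ih =>
    obtain ⟨rfl, he, hp⟩ := hp
    have hv : e.tgt.IsVertex := he.elim (fun h => (Edge.Up.isVertex h).2)
      (fun h => (Edge.Down.isVertex h).2)
    rw [toWord_cons, pathCls_betaPath_mul, pathCls_betaPath_mul, ih hv hp, pathCls_cons,
      pathCls_betaPath_of, pathCls_betaPath_anc, Gen.letterCls_eq hg]
    change _ = upCls e.src * (e.cls * pathCls p) * downCls k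
    rw [← he.bridge]
    simp only [mul_assoc]

/-- The longer sides are landscapes. After the outer hills are added, `left` and `right` are the
recursions for the left and the right hill of `g`, while `middle` is the uplifting of the river
covered by `g`. -/
theorem pathCls_eq_of_relS {u v : Word} (h : RelS u v) :
    pathCls (betaPath u) = pathCls (betaPath v) := by
  cases h with
  | left g hg h2 =>
    obtain ⟨h3, -⟩ := Gen.tuple_entries hg h2
    have e : Word.of g.c * wordL g * Word.of g = toWord g.c [g.eLC.inv, g.eL.inv] := by
      rw [Gen.inv_inv_la, wordL]; rfl
    have hp : IsPath g.c [g.eLC.inv, g.eL.inv] g := ⟨rfl, Or.inl (Edge.inv_up_iff.2 h3), rfl,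
      Or.inl (Edge.inv_up_iff.2 (Gen.eL_down hg)), rfl⟩
    rw [e, pathCls_betaPath_toWord (Gen.c_isVertex hg h2) hp, pathCls_betaPath_of,
      Gen.letterCls_eq (Or.inl hg), Gen.upCls_eq hg h2]
    rfl
  | right g hg h2 =>
    obtain ⟨-, h3, -⟩ := Gen.tuple_entries hg h2
    have hp : IsPath g [g.eR, g.eRC] g.c := ⟨rfl, Or.inr (Gen.eR_down hg), rfl, Or.inr h3, rfl⟩
    have e : Word.of g * wordR g * Word.of g.c = toWord g [g.eR, g.eRC] := rfl
    rw [e, pathCls_betaPath_toWord (Or.inl hg) hp, pathCls_betaPath_of,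
      Gen.letterCls_eq (Or.inl hg), Gen.downCls_eq hg h2, mul_assoc, pathCls_cons, mul_assoc]
    rfl
  | middle g hg h2 =>
    obtain ⟨h3, h4, -⟩ := Gen.tuple_entries hg h2
    have hp : IsPath g.r [g.eR.inv, g.eL] g.l := ⟨rfl, Or.inl (Edge.inv_up_iff.2 (Gen.eR_down hg)),
      rfl, Or.inr (Gen.eL_down hg), rfl⟩
    have hq : IsPath g.r [g.eRC, g.eLC.inv] g.l := ⟨rfl, Or.inr h4, rfl,
      Or.inl (Edge.inv_up_iff.2 h3), rfl⟩
    have hv : g.r.IsVertex := (Gen.eR_down hg).isVertex.2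
    have e1 : Word.of g.r * Word.anc g.ra * Word.of g * Word.anc g.la.inv * Word.of g.l =
        toWord g.r [g.eR.inv, g.eL] := by
      rw [← Anchor.inv_inv g.ra]; rfl
    have e2 : Word.of g.r * Word.anc g.ra * Word.of g.c * Word.anc g.la.inv * Word.of g.l =
        toWord g.r [g.eRC, g.eLC.inv] := rfl
    rw [e1, e2, pathCls_betaPath_toWord hv hp, pathCls_betaPath_toWord hv hq, pathCls_cons,
      pathCls_cons g.eRC]
    exact congrArg (_ * · * _) (Gen.cls_eRC_mul hg h2).symm

/-- Forwards, `ρ` is the smallest congruence containing the relations, and `betaCon` is one such.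
Backwards, the two paths have a common reduct, and uplifting stays inside a `ρ`-class. -/
theorem cls_eq_iff {u v : Word} :
    cls u = cls v ↔ pathCls (betaPath u) = pathCls (betaPath v) := by
  constructor
  · intro h
    have h' : rho u v := (Con.eq _).1 h
    have hle : rho ≤ betaCon :=
      Con.conGen_le.2 fun u v h => h.elim pathCls_eq_of_relE pathCls_eq_of_relS
    exact hle h'
  · intro h
    obtain ⟨r, h1, h2⟩ := exists_common_of_pathCls_eq h
    rw [← cls_betaPath u, ← cls_betaPath v, cls_eq_of_reflTransGen h1 (isPath_betaPath u),
      cls_eq_of_reflTransGen h2 (isPath_betaPath v)]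

/-! ### The unique mountain of a class -/

/-- The mountain of a word. -/
noncomputable def mountain (u : Word) : Word := toWord .one (normalize (betaPath u))

theorem isVertex_one : Gen.one.IsVertex := Or.inr rfl

theorem isPath_normalize_betaPath (u : Word) : IsPath .one (normalize (betaPath u)) .one :=
  reflTransGen_isPath (normalize_reduces _) (isPath_betaPath u)

theorem isNormalForm_iff {u m : Word} : IsNormalForm u m ↔ m = mountain u := by
  have hp := isPath_normalize_betaPath u
  have hn := normalize_irreducible (isPath_betaPath u)
  rw [IsNormalForm, beta1_eq]
  constructor
  · rintro ⟨h1, h2⟩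
    obtain ⟨q, h3, rfl⟩ := (isPath_betaPath u).reflTransGen_step h1
    rw [(reflTransGen_isPath h3 (isPath_betaPath u)).hasRiver_iff isVertex_one] at h2
    have : pathCls q = pathCls (normalize (betaPath u)) :=
      (reflTransGen_pathCls_eq h3).symm.trans (reflTransGen_pathCls_eq (normalize_reduces _))
    rw [mountain, eq_of_pathCls_eq (not_exists.1 h2) hn this]
  · rintro rfl
    refine ⟨reflTransGen_uplift (normalize_reduces _) isVertex_one (isPath_betaPath u), ?_⟩
    rw [mountain, hp.hasRiver_iff isVertex_one]
    exact not_exists.2 hn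

theorem beta_eq_mountain (u : Word) : beta u = mountain u :=
  isNormalForm_iff.1 (Classical.epsilon_spec_aux _ (IsNormalForm u) ⟨_, isNormalForm_iff.2 rfl⟩)

theorem isMountain_mountain (u : Word) : IsMountain (mountain u) := by
  have hp := isPath_normalize_betaPath u
  refine ⟨⟨isLandscape_toWord isVertex_one hp, rfl, ?_⟩, (isNormalForm_iff.2 rfl).2⟩
  obtain ⟨P, h1, -⟩ := hp.exists_letters
  rw [mountain, letters_toWord, h1, List.getLast?_append]
  rfl

theorem cls_mountain (u : Word) : cls (mountain u) = cls u := by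
  rw [mountain, ← cls_eq_of_reflTransGen (normalize_reduces _) (isPath_betaPath u), cls_betaPath]

theorem cls_eq_iff_normalize {u v : Word} :
    cls u = cls v ↔ normalize (betaPath u) = normalize (betaPath v) :=
  cls_eq_iff.trans (pathCls_eq_iff_normalize (isPath_betaPath u) (isPath_betaPath v))

theorem cls_eq_iff_mountain {u v : Word} : cls u = cls v ↔ mountain u = mountain v :=
  ⟨fun h => by rw [mountain, cls_eq_iff_normalize.1 h]; rfl,
    fun h => by rw [← cls_mountain u, h, cls_mountain]⟩

/-- The hills of `1` are empty, so `β₁(m)` has the same class as the path of `m`. That path has no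
river, hence it is the normal form. -/
theorem IsMountain.mountain_eq {m : Word} (h : IsMountain m) : mountain m = m := by
  obtain ⟨⟨h1, h2, h3⟩, h4⟩ := h
  obtain ⟨hv, p, k, hp, hm⟩ := h1.exists_path
  have h5 : m.head = .one := by simpa [Word.letters] using h2
  rw [h5] at hp hm
  rw [hm] at h3 h4
  obtain ⟨P, h6, -⟩ := hp.exists_letters
  rw [letters_toWord, h6, List.getLast?_append] at h3
  obtain rfl : k = .one := by simpa using h3
  rw [hp.hasRiver_iff isVertex_one] at h4
  have h7 : pathCls (betaPath m) = pathCls p := by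
    rw [hm, pathCls_betaPath_toWord isVertex_one hp, Gen.upCls_one, Gen.downCls_one, one_mul,
      mul_one]
  rw [mountain, eq_of_pathCls_eq (normalize_irreducible (isPath_betaPath m)) (not_exists.1 h4)
    ((reflTransGen_pathCls_eq (normalize_reduces _)).symm.trans h7), ← hm]

/-! ### Gödel numbers of the generators -/

open Classical in
/-- The coding of a type by an injective function with primitive recursive range. -/
@[reducible]
noncomputable def primcodableOfInjective {β : Type*} (f : β → ℕ) (hf : Function.Injective f)
    (hp : PrimrecPred (· ∈ Set.range f)) : Primcodable β :=
  letI : Primcodable {n // n ∈ Set.range f} := Primcodable.subtype hp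
  Primcodable.ofEquiv {n // n ∈ Set.range f} (Equiv.ofInjective f hf)

namespace Symb

/-- The code of `g^l` in terms of the code of the tuple `g`. -/
def codeL (n : ℕ) : ℕ := (n - 3).unpair.1
/-- The code of `g^la`. -/
def codeLa (n : ℕ) : ℕ := (n - 3).unpair.2.unpair.1
/-- The code of `g^c`. -/
def codeC (n : ℕ) : ℕ := (n - 3).unpair.2.unpair.2.unpair.1
/-- The code of `g^ra`. -/
def codeRa (n : ℕ) : ℕ := (n - 3).unpair.2.unpair.2.unpair.2.unpair.1
/-- The code of `g^r`. -/
def codeR (n : ℕ) : ℕ := (n - 3).unpair.2.unpair.2.unpair.2.unpair.2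
/-- The code of the inverse anchor. -/
def codeInv (n : ℕ) : ℕ := if n = 1 then 2 else if n = 2 then 1 else n

theorem primrec_sub_three : Primrec fun n : ℕ => n - 3 := Primrec.nat_sub.comp .id (.const 3)

theorem primrec_codeL : Primrec codeL := Primrec.fst.comp (Primrec.unpair.comp primrec_sub_three)

theorem primrec_unpair_snd : Primrec fun n : ℕ => n.unpair.2 := Primrec.snd.comp Primrec.unpair
theorem primrec_unpair_fst : Primrec fun n : ℕ => n.unpair.1 := Primrec.fst.comp Primrec.unpair

theorem primrec_codeLa : Primrec codeLa :=
  primrec_unpair_fst.comp (primrec_unpair_snd.comp primrec_sub_three)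

theorem primrec_codeC : Primrec codeC :=
  primrec_unpair_fst.comp (primrec_unpair_snd.comp (primrec_unpair_snd.comp primrec_sub_three))

theorem primrec_codeRa : Primrec codeRa :=
  primrec_unpair_fst.comp (primrec_unpair_snd.comp (primrec_unpair_snd.comp
    (primrec_unpair_snd.comp primrec_sub_three)))

theorem primrec_codeR : Primrec codeR :=
  primrec_unpair_snd.comp (primrec_unpair_snd.comp (primrec_unpair_snd.comp
    (primrec_unpair_snd.comp primrec_sub_three)))

theorem primrec_codeInv : Primrec codeInv :=
  Primrec.ite (Primrec.eq.comp .id (.const 1)) (.const 2)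
    (Primrec.ite (Primrec.eq.comp .id (.const 2)) (.const 1) .id)

theorem code_inv (a : Anchor) : a.inv.code = codeInv a.code := by cases a <;> rfl

theorem anchorCode_injective : Function.Injective Anchor.code := by
  intro a b; cases a <;> cases b <;> simp [Anchor.code]

theorem anchorCode_lt (a : Anchor) : a.code < 3 := by cases a <;> decide

/-- `IsDown` in terms of codes. -/
def CodeDown (m c a : ℕ) : Prop :=
  (c = codeL m ∧ a = codeInv (codeLa m)) ∨ (c = codeR m ∧ a = codeInv (codeRa m))

theorem code_entries (l : Symb) (la : Anchor) (c : Symb) (ra : Anchor) (r : Symb) :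
    codeL (tup l la c ra r).code = l.code ∧ codeLa (tup l la c ra r).code = la.code ∧
    codeC (tup l la c ra r).code = c.code ∧ codeRa (tup l la c ra r).code = ra.code ∧
    codeR (tup l la c ra r).code = r.code := by
  simp [codeL, codeLa, codeC, codeRa, codeR, code]

theorem codeDown_iff {l : Symb} (hl : Tuple l) {m a : ℕ} :
    CodeDown l.code m a ↔ ∃ c b, IsDown l c b ∧ c.code = m ∧ b.code = a := by
  cases l with
  | anc b => exact absurd hl (not_tuple_anc b)
  | tup l la c ra r =>
    obtain ⟨h1, h2, h3, h4, h5⟩ := code_entries l la c ra r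
    unfold CodeDown IsDown
    rw [h1, h2, h4, h5, ← code_inv, ← code_inv]
    simp only [Symb.l, Symb.la, Symb.r, Symb.ra, Prod.mk.injEq]
    constructor
    · rintro (⟨rfl, rfl⟩ | ⟨rfl, rfl⟩)
      · exact ⟨_, _, Or.inl ⟨rfl, rfl⟩, rfl, rfl⟩
      · exact ⟨_, _, Or.inr ⟨rfl, rfl⟩, rfl, rfl⟩
    · rintro ⟨_, _, ⟨rfl, rfl⟩ | ⟨rfl, rfl⟩, rfl, rfl⟩
      · exact Or.inl ⟨rfl, rfl⟩
      · exact Or.inr ⟨rfl, rfl⟩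

/-- `n` is the code of a tuple of `G⁵`. -/
def IsTupleCode (n : ℕ) : Prop := ∃ s, Tuple s ∧ s.code = n

/-- The conditions on the code of a tuple other than those on the entries `g^l` and `g^r`. -/
def CodeLocal (n : ℕ) : Prop :=
  CodeDown (codeL n) (codeC n) (codeLa n) ∧ CodeDown (codeR n) (codeC n) (codeRa n) ∧
    ¬ (codeL n = codeR n ∧ codeLa n = codeRa n)

/-- This is the recursion by which membership is decided. The bound `3 ≤ n` keeps the truncated
subtraction in `codeL` and its companions honest. The middle entry needs no recursive call, since
`CodeLocal` places it below the left entry. -/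
theorem isTupleCode_iff (n : ℕ) : IsTupleCode n ↔ 3 ≤ n ∧ (n = gxx.code ∨
    (IsTupleCode (codeL n) ∧ IsTupleCode (codeR n)) ∧ CodeLocal n) := by
  constructor
  · rintro ⟨s, hs, rfl⟩
    cases hs with
    | gxx => exact ⟨by simp [Symb.gxx, code], Or.inl rfl⟩
    | tup l la c ra r hl hr hcl hcr hne =>
      refine ⟨by simp [code], Or.inr ?_⟩
      obtain ⟨h1, h2, h3, h4, h5⟩ := code_entries l la c ra r
      unfold CodeLocal
      rw [h1, h2, h3, h4, h5]
      refine ⟨⟨⟨l, hl, rfl⟩, ⟨r, hr, rfl⟩⟩, (codeDown_iff hl).2 ⟨_, _, hcl, rfl, rfl⟩,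
        (codeDown_iff hr).2 ⟨_, _, hcr, rfl, rfl⟩, fun h => hne ?_⟩
      rw [code_injective h.1, anchorCode_injective h.2]
  · rintro ⟨h3, rfl | ⟨⟨⟨l, hl, h1⟩, ⟨r, hr, h2⟩⟩, h4, h5, h6⟩⟩
    · exact ⟨_, .gxx, rfl⟩
    · rw [← h1] at h4 h6
      rw [← h2] at h5 h6
      obtain ⟨c, la, hd, hc, ha⟩ := (codeDown_iff hl).1 h4
      obtain ⟨c', ra, hd', hc', ha'⟩ := (codeDown_iff hr).1 h5
      obtain rfl : c = c' := code_injective (hc.trans hc'.symm)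
      refine ⟨_, .tup l la c ra r hl hr hd hd' ?_, ?_⟩
      · rw [← ha, ← ha'] at h6
        intro h
        simp only [Prod.mk.injEq] at h
        exact h6 ⟨by rw [h.1], by rw [h.2]⟩
      · rw [code, h1, h2, hc, ha, ha']
        simp only [codeL, codeLa, codeC, codeRa, codeR, Nat.pair_unpair]
        omega

theorem primrecPred_codeDown {α : Type*} [Primcodable α] {m c a : α → ℕ} (hm : Primrec m)
    (hc : Primrec c) (ha : Primrec a) : PrimrecPred fun z => CodeDown (m z) (c z) (a z) :=
  ((Primrec.eq.comp hc (primrec_codeL.comp hm)).and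
    (Primrec.eq.comp ha (primrec_codeInv.comp (primrec_codeLa.comp hm)))).or
  ((Primrec.eq.comp hc (primrec_codeR.comp hm)).and
    (Primrec.eq.comp ha (primrec_codeInv.comp (primrec_codeRa.comp hm))))

theorem primrecPred_codeLocal : PrimrecPred CodeLocal :=
  (primrecPred_codeDown primrec_codeL primrec_codeC primrec_codeLa).and
    ((primrecPred_codeDown primrec_codeR primrec_codeC primrec_codeRa).and
      ((Primrec.eq.comp primrec_codeL primrec_codeR).and
        (Primrec.eq.comp primrec_codeLa primrec_codeRa)).not)

open Classical in
theorem primrecPred_isTupleCode : PrimrecPred IsTupleCode := by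
  -- In the course-of-values recursion, `l` lists the truth values at `0, …, n - 1`, so `l.length`
  -- is the argument `n` itself.
  let g : List Bool → Prop := fun l => 3 ≤ l.length ∧ (l.length = gxx.code ∨
    (l.getD (codeL l.length) false = true ∧ l.getD (codeR l.length) false = true) ∧
      CodeLocal l.length)
  have hlen : Primrec fun l : List Bool => l.length := Primrec.list_length
  have hg : PrimrecPred g :=
    (Primrec.nat_le.comp (.const 3) hlen).and ((Primrec.eq.comp hlen (.const _)).or
      (((Primrec.eq.comp ((Primrec.list_getD false).comp .id (primrec_codeL.comp hlen))
          (.const true)).and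
        (Primrec.eq.comp ((Primrec.list_getD false).comp .id (primrec_codeR.comp hlen))
          (.const true))).and (primrecPred_codeLocal.comp hlen)))
  have h : Primrec₂ fun (_ : Unit) (n : ℕ) => decide (IsTupleCode n) := by
    refine Primrec.nat_strong_rec _ (g := fun _ l => some (decide (g l))) ?_ ?_
    · exact (Primrec.option_some.comp (hg.decide.comp Primrec.snd)).to₂
    · intro _ n
      simp only [Option.some.injEq, decide_eq_decide]
      rw [isTupleCode_iff]
      simp only [g, List.length_map, List.length_range]
      -- From `3 ≤ n` the numbers `codeL n` and `codeR n` are at most `n - 3 < n`, so their values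
      -- are already in the table.
      refine and_congr_right fun h3 => ?_
      have e1 : codeL n < n := by
        have := Nat.unpair_left_le (n - 3)
        unfold codeL; omega
      have e2 : codeR n < n := by
        have h1 := Nat.unpair_right_le (n - 3)
        have h2 := Nat.unpair_right_le (n - 3).unpair.2
        have h3 := Nat.unpair_right_le (n - 3).unpair.2.unpair.2
        have h4 := Nat.unpair_right_le (n - 3).unpair.2.unpair.2.unpair.2
        unfold codeR; omega
      simp [e1, e2]
  exact Primrec.primrecPred (h.comp (.const ()) .id)

theorem mem_range_code_iff (n : ℕ) :
    n ∈ Set.range (fun g : Gen => g.1.code) ↔ n < 3 ∨ IsTupleCode n := by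
  constructor
  · rintro ⟨g, rfl⟩
    rcases g.isTuple_or with h | ⟨a, rfl⟩
    · exact Or.inr ⟨_, Gen.isTuple_iff.1 h, rfl⟩
    · exact Or.inl (anchorCode_lt a)
  · rintro (h | ⟨s, hs, rfl⟩)
    · interval_cases n
      · exact ⟨.anc .one, rfl⟩
      · exact ⟨.anc .x, rfl⟩
      · exact ⟨.anc .xinv, rfl⟩
    · exact ⟨⟨s, Or.inl (mem_G5_iff.2 hs)⟩, rfl⟩

/-- This supplies a computable bound for the number of iterations that build a hill. -/
theorem height_le_code (s : Symb) : s.height ≤ s.code := by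
  induction s with
  | anc a => exact Nat.zero_le _
  | tup l la c ra r hl hc hr =>
    have := Nat.left_le_pair l.code (Nat.pair la.code (Nat.pair c.code (Nat.pair ra.code r.code)))
    simp only [height, code]
    omega

end Symb

open Symb

theorem Gen.code_injective : Function.Injective fun g : Gen => g.1.code :=
  Symb.code_injective.comp Subtype.val_injective

theorem Gen.primrecPred_mem_range : PrimrecPred (· ∈ Set.range fun g : Gen => g.1.code) :=
  ((Primrec.nat_lt.comp .id (.const 3)).or primrecPred_isTupleCode).of_eq
    fun n => (mem_range_code_iff n).symm

noncomputable instance : Primcodable Gen :=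
  primcodableOfInjective _ Gen.code_injective Gen.primrecPred_mem_range

noncomputable instance : Primcodable Anchor :=
  primcodableOfInjective Anchor.code anchorCode_injective
    ((Primrec.nat_lt.comp .id (.const 3)).of_eq fun n => by
      constructor
      · intro (h : n < 3)
        interval_cases n
        · exact ⟨.one, rfl⟩
        · exact ⟨.x, rfl⟩
        · exact ⟨.xinv, rfl⟩
      · rintro ⟨a, rfl⟩
        exact anchorCode_lt a)

/-! ### Primitive recursiveness of `β₁` and of the normal form -/

section Primrec

variable {α : Type*} [Primcodable α]

theorem Gen.primrec_code : Primrec fun g : Gen => g.1.code := Primrec.encode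

theorem Gen.primrec_iff {f : α → Gen} : Primrec f ↔ Primrec fun a => (f a).1.code :=
  Primrec.encode_iff.symm

theorem Anchor.primrec_code : Primrec Anchor.code := Primrec.encode

theorem Anchor.primrec_iff {f : α → Anchor} : Primrec f ↔ Primrec fun a => (f a).code :=
  Primrec.encode_iff.symm

theorem Anchor.primrec_inv : Primrec Anchor.inv :=
  Anchor.primrec_iff.2 ((primrec_codeInv.comp Anchor.primrec_code).of_eq fun a => (code_inv a).symm)

/-- A function on letters that is primitive recursive on codes of tuples and `0` at anchors. -/
theorem Gen.primrec_of_tuple {f : Gen → ℕ} {F : ℕ → ℕ} (hF : Primrec F)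
    (h0 : ∀ a, f (anc a) = 0) (h : ∀ l la c ra r hg, f ⟨tup l la c ra r, hg⟩ =
      F (tup l la c ra r).code) : Primrec f := by
  refine (Primrec.ite (c := fun g : Gen => g.1.code < 3) (Primrec.nat_lt.comp primrec_code (.const 3))
    (.const 0) (hF.comp primrec_code)).of_eq ?_
  rintro ⟨g, hg⟩
  cases g with
  | anc a => exact (if_pos (anchorCode_lt a)).trans (h0 a).symm
  | tup l la c ra r => rw [if_neg (by simp [code]), h]

theorem Gen.primrec_l : Primrec Gen.l :=
  primrec_iff.2 (primrec_of_tuple primrec_codeL (fun _ => rfl)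
    fun l la c ra r _ => (code_entries l la c ra r).1.symm)

theorem Gen.primrec_la : Primrec Gen.la :=
  Anchor.primrec_iff.2 (primrec_of_tuple primrec_codeLa (fun _ => rfl)
    fun l la c ra r _ => (code_entries l la c ra r).2.1.symm)

theorem Gen.primrec_c : Primrec Gen.c :=
  primrec_iff.2 (primrec_of_tuple primrec_codeC (fun _ => rfl)
    fun l la c ra r _ => (code_entries l la c ra r).2.2.1.symm)

theorem Gen.primrec_ra : Primrec Gen.ra :=
  Anchor.primrec_iff.2 (primrec_of_tuple primrec_codeRa (fun _ => rfl)
    fun l la c ra r _ => (code_entries l la c ra r).2.2.2.1.symm)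

theorem Gen.primrec_r : Primrec Gen.r :=
  primrec_iff.2 (primrec_of_tuple primrec_codeR (fun _ => rfl)
    fun l la c ra r _ => (code_entries l la c ra r).2.2.2.2.symm)

open Classical in
/-- The letter with code `n`, if there is one. -/
noncomputable def Gen.ofCode (n : ℕ) : Gen :=
  if h : n ∈ Set.range (fun g : Gen => g.1.code) then h.choose else .one

theorem Gen.code_ofCode {n : ℕ} (h : n ∈ Set.range (fun g : Gen => g.1.code)) :
    (ofCode n).1.code = n := by
  rw [ofCode, dif_pos h]
  exact h.choose_spec

theorem Gen.ofCode_code (g : Gen) : ofCode g.1.code = g :=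
  code_injective (code_ofCode ⟨g, rfl⟩)

/-- Both functions take the default value `one`, so `Edge.peak` can be computed on codes for all
pairs of edges and not only for rivers. -/
theorem Gen.ofSymb_eq (s : Symb) : ofSymb s = ofCode s.code := by
  by_cases h : s ∈ G
  · have := ofSymb_coe ⟨s, h⟩
    rw [this]
    exact (ofCode_code ⟨s, h⟩).symm
  · rw [ofSymb, dif_neg h, ofCode, dif_neg]
    rintro ⟨g, hg⟩
    exact h (Symb.code_injective hg ▸ g.2)

open Classical in
theorem Gen.primrec_ofCode : Primrec ofCode := by
  -- The constant `0` is the code of the default letter `1`.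
  refine primrec_iff.2 ((Primrec.ite primrecPred_mem_range .id (.const 0)).of_eq fun n => ?_)
  split
  · next h => exact (code_ofCode h).symm
  · next h => rw [ofCode, dif_neg h]; rfl

theorem Edge.primrec_inv : Primrec Edge.inv :=
  (Primrec.snd.comp .snd).pair ((Anchor.primrec_inv.comp (Primrec.fst.comp .snd)).pair .fst)

theorem Edge.primrec_src : Primrec Edge.src := Primrec.fst
theorem Edge.primrec_lab : Primrec Edge.lab := Primrec.fst.comp .snd
theorem Edge.primrec_tgt : Primrec Edge.tgt := Primrec.snd.comp .snd

theorem Edge.primrec_peak : Primrec₂ Edge.peak := by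
  have h1 {f : Edge × Edge → Gen} (hf : Primrec f) : Primrec fun z => (f z).1.code :=
    Gen.primrec_code.comp hf
  have h2 {f : Edge × Edge → Anchor} (hf : Primrec f) : Primrec fun z => (f z).code :=
    Anchor.primrec_code.comp hf
  have h : Primrec fun z : Edge × Edge => Gen.ofCode (3 + Nat.pair z.2.tgt.1.code
      (Nat.pair z.2.lab.inv.code (Nat.pair z.2.src.1.code
        (Nat.pair z.1.lab.code z.1.src.1.code)))) :=
    Gen.primrec_ofCode.comp <| Primrec.nat_add.comp (.const 3) <|
      Primrec₂.natPair.comp (h1 (primrec_tgt.comp .snd)) <|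
      Primrec₂.natPair.comp (h2 (Anchor.primrec_inv.comp (primrec_lab.comp .snd))) <|
      Primrec₂.natPair.comp (h1 (primrec_src.comp .snd)) <|
      Primrec₂.natPair.comp (h2 (primrec_lab.comp .fst)) (h1 (primrec_src.comp .fst))
  exact h.of_eq fun z =>
    (Gen.ofSymb_eq (.tup z.2.tgt.1 z.2.lab.inv z.2.src.1 z.1.lab z.1.src.1)).symm

theorem Gen.primrecPred_isTuple : PrimrecPred Gen.IsTuple := by
  refine (Primrec.nat_lt.comp primrec_code (.const 3)).not.of_eq fun g => ?_
  rcases g.isTuple_or with h | ⟨a, rfl⟩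
  · refine iff_of_true ?_ h
    have h := isTuple_iff.1 h
    generalize g.1 = s at *
    cases s with
    | anc a => exact absurd h (not_tuple_anc a)
    | tup l la c ra r => simp [code]
  · exact iff_of_false (not_not.2 (anchorCode_lt a)) (not_isTuple_anc a)

theorem Edge.primrecPred_down : PrimrecPred Edge.Down :=
  (Gen.primrecPred_isTuple.comp primrec_src).and
    ((Primrec.eq.comp (primrec_tgt.pair primrec_lab)
      ((Gen.primrec_l.comp primrec_src).pair
        (Anchor.primrec_inv.comp (Gen.primrec_la.comp primrec_src)))).or
    (Primrec.eq.comp (primrec_tgt.pair primrec_lab)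
      ((Gen.primrec_r.comp primrec_src).pair
        (Anchor.primrec_inv.comp (Gen.primrec_ra.comp primrec_src)))))

theorem Edge.primrecPred_up : PrimrecPred Edge.Up :=
  (primrecPred_down.comp primrec_inv).of_eq fun _ => up_iff.symm

theorem Edge.primrecRel_river : PrimrecRel Edge.River :=
  (primrecPred_down.comp Primrec.fst).and ((primrecPred_up.comp Primrec.snd).and
    (Primrec.eq.comp (primrec_tgt.comp .fst) (primrec_src.comp .snd)))

theorem primrec_sweep : Primrec₂ sweep := by
  classical
  let A := Edge × (Option Edge × List Edge)
  have hd : Primrec fun z : A × Edge => z.1.1 := Primrec.fst.comp .fst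
  have hout : Primrec fun z : A × Edge => z.1.2.2 := Primrec.snd.comp (Primrec.snd.comp .fst)
  have hc : Primrec fun z : A × Edge => z.2 := Primrec.snd
  have hk : Primrec fun z : A × Edge => Edge.peak z.1.1 z.2 := Edge.primrec_peak.comp hd hc
  have h : Primrec₂ fun (a : A) (c : Edge) =>
      if Edge.River a.1 c then
        if a.1 = c.inv then (none, a.2.2)
        else (some (a.1.src, a.1.lab, Edge.peak a.1 c), (Edge.peak a.1 c, c.lab, c.tgt) :: a.2.2)
      else (none, a.1 :: c :: a.2.2) := by
    refine Primrec.ite (Edge.primrecRel_river.comp hd hc)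
      (Primrec.ite (Primrec.eq.comp hd (Edge.primrec_inv.comp hc)) ?_ ?_) ?_
    · exact (Primrec.const none).pair hout
    · exact (Primrec.option_some.comp ((Edge.primrec_src.comp hd).pair
        ((Edge.primrec_lab.comp hd).pair hk))).pair (Primrec.list_cons.comp
          (hk.pair ((Edge.primrec_lab.comp hc).pair (Edge.primrec_tgt.comp hc))) hout)
    · exact (Primrec.const none).pair (Primrec.list_cons.comp hd (Primrec.list_cons.comp hc hout))
  have h0 : Primrec fun a : A => ((none, a.1 :: a.2.2) : Option Edge × List Edge) :=
    (Primrec.const none).pair (Primrec.list_cons.comp .fst (Primrec.snd.comp .snd))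
  refine (Primrec.option_casesOn (Primrec.fst.comp Primrec.snd) h0 h).of_eq ?_
  rintro ⟨d, c, out⟩
  cases c with
  | none => rfl
  | some c => simp only [sweep]

theorem primrec_push : Primrec₂ push := by
  have h : Primrec fun z : List Edge × Edge => z.1.foldr sweep (some z.2, []) :=
    Primrec.list_foldr (h := fun _ y => sweep y.1 y.2) .fst
      ((Primrec.option_some.comp .snd).pair (.const []))
      ((primrec_sweep.comp (Primrec.fst.comp .snd) (Primrec.snd.comp .snd)).to₂)
  exact Primrec.list_append.comp (Primrec.optionToList.comp (Primrec.fst.comp h))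
    (Primrec.snd.comp h)

theorem primrec_normalize : Primrec normalize :=
  Primrec.list_foldl (h := fun _ y => push y.1 y.2) .id (.const [])
    ((primrec_push.comp (Primrec.fst.comp .snd) (Primrec.snd.comp .snd)).to₂)

open Classical in
/-- Two more edges on each side of the outer parts of a mountain. -/
noncomputable def extend (z : Gen × List Edge × List Edge) : Gen × List Edge × List Edge :=
  if z.1 = .one then z
  else if z.1 = .gxx then
    (.one, (.one, .one, .gxx) :: z.2.1, z.2.2 ++ [(.gxx, .one, .one)])
  else (z.1.c, z.1.eLC.inv :: z.1.eL.inv :: z.2.1, z.2.2 ++ [z.1.eR, z.1.eRC])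

/-- The iteration builds both hills at once from the summit down to `1`, using `p` and `q` as
accumulators. Since `1` is fixed by `extend`, surplus iterations do no harm and any bound on the
height suffices. -/
theorem iterate_extend {g : Gen} (hg : g.IsVertex) (p q : List Edge) {k : ℕ} (hk : g.height ≤ k) :
    (extend^[k] (g, p, q)).2 = (upPath g.height g ++ p, q ++ downPath g.height g) := by
  have h1 : ∀ k p q, extend^[k] (.one, p, q) = (.one, p, q) := by
    intro k p q
    induction k with
    | zero => rfl
    | succ k ih => rw [Function.iterate_succ_apply]; simpa [extend] using ih
  generalize hn : g.height = n
  induction n using Nat.strong_induction_on generalizing g p q k with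
  | _ n ih =>
  rcases hg with hg | rfl
  · obtain ⟨k, rfl⟩ : ∃ j, k = j + 1 := ⟨k - 1, by have := Gen.height_pos hg; omega⟩
    have hne : g ≠ .one := fun e => Gen.not_isTuple_anc .one (show Gen.IsTuple .one from e ▸ hg)
    rw [Function.iterate_succ_apply]
    by_cases h2 : 2 ≤ g.height
    · have h3 := Gen.height_c hg h2
      obtain rfl : n = g.c.height + 2 := by omega
      have h4 : extend (g, p, q) =
          (g.c, g.eLC.inv :: g.eL.inv :: p, q ++ [g.eR, g.eRC]) := by
        simp [extend, hne, Gen.ne_gxx_of_height h2]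
      rw [h4, ih g.c.height (by omega) (Gen.c_isVertex hg h2) _ _ (by omega) rfl]
      simp [upPath, downPath]
    · have := Gen.height_pos hg
      obtain rfl := Gen.eq_gxx hg (by omega)
      subst hn
      have h4 : extend (.gxx, p, q) =
          (.one, (.one, .one, .gxx) :: p, q ++ [(.gxx, .one, .one)]) := by
        simp [extend, hne]
      rw [h4, h1]
      rfl
  · subst hn
    rw [h1]
    change _ = ([] ++ p, q ++ [])
    simp

theorem primrec_extend : Primrec extend := by
  have h1 : Primrec fun z : Gen × List Edge × List Edge => z.1 := .fst
  have h2 : Primrec fun z : Gen × List Edge × List Edge => z.2.1 := Primrec.fst.comp .snd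
  have h3 : Primrec fun z : Gen × List Edge × List Edge => z.2.2 := Primrec.snd.comp .snd
  have hL : Primrec Gen.eL := Primrec.id.pair
    ((Anchor.primrec_inv.comp Gen.primrec_la).pair Gen.primrec_l)
  have hR : Primrec Gen.eR := Primrec.id.pair
    ((Anchor.primrec_inv.comp Gen.primrec_ra).pair Gen.primrec_r)
  have hLC : Primrec Gen.eLC := Gen.primrec_l.pair (Gen.primrec_la.pair Gen.primrec_c)
  have hRC : Primrec Gen.eRC := Gen.primrec_r.pair (Gen.primrec_ra.pair Gen.primrec_c)
  refine Primrec.ite (Primrec.eq.comp h1 (.const _)) .id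
    (Primrec.ite (Primrec.eq.comp h1 (.const _)) ?_ ?_)
  · exact (Primrec.const _).pair ((Primrec.list_cons.comp (.const _) h2).pair
      (Primrec.list_append.comp h3 (.const _)))
  · exact (Gen.primrec_c.comp h1).pair ((Primrec.list_cons.comp
      (Edge.primrec_inv.comp (hLC.comp h1)) (Primrec.list_cons.comp
        (Edge.primrec_inv.comp (hL.comp h1)) h2)).pair
      (Primrec.list_append.comp h3 (Primrec.list_cons.comp (hR.comp h1)
        (Primrec.list_cons.comp (hRC.comp h1) (.const [])))))

theorem primrec_letterPath : Primrec letterPath := by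
  classical
  have h : Primrec fun g : Gen => extend^[g.1.code] (g, [], []) :=
    Primrec.nat_iterate (h := fun _ z => extend z) Gen.primrec_code
      (Primrec.id.pair (.const _)) (primrec_extend.comp .snd).to₂
  refine (Primrec.ite (Primrec.eq.comp .id (.const (Gen.anc .one)))
    (.const (letterPath (.anc .one))) (Primrec.ite (Primrec.eq.comp .id (.const (Gen.anc .x)))
    (.const (letterPath (.anc .x))) (Primrec.ite (Primrec.eq.comp .id (.const (Gen.anc .xinv)))
    (.const (letterPath (.anc .xinv)))
    (Primrec.list_append.comp (Primrec.fst.comp (Primrec.snd.comp h))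
      (Primrec.snd.comp (Primrec.snd.comp h)))))).of_eq ?_
  intro g
  rcases g.isTuple_or with h | ⟨a, rfl⟩
  · have hne : ∀ a, g ≠ .anc a := fun a e => Gen.not_isTuple_anc a (e ▸ h)
    simp only [id_eq, hne, if_false]
    rw [iterate_extend (Or.inl h) [] [] (height_le_code g.1), letterPath_of_isTuple h]
    simp
  · cases a
    · simp
    · simp [Gen.anc_injective.eq_iff]
    · simp [Gen.anc_injective.eq_iff]

end Primrec

/-! ### The decision procedure -/

/-- The letters whose codes are given. -/
noncomputable def decodeLetters (w : List ℕ) : List Gen := w.map Gen.ofCode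

theorem decodeLetters_wordCode (u : Word) : decodeLetters (wordCode u) = u.letters := by
  unfold decodeLetters wordCode
  rw [List.map_map]
  conv_rhs => rw [← List.map_id u.letters]
  exact List.map_congr_left fun g _ => Gen.ofCode_code g

/-- Numbers that are not codes decode to the default letter, and encoding again exposes them. -/
theorem exists_wordCode_iff (w : List ℕ) : (∃ u : Word, wordCode u = w) ↔
    w ≠ [] ∧ (decodeLetters w).map (fun g => g.1.code) = w := by
  constructor
  · rintro ⟨u, rfl⟩
    exact ⟨by simp [wordCode, Word.letters], by rw [decodeLetters_wordCode]; rfl⟩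
  · rintro ⟨h1, h2⟩
    cases w with
    | nil => exact absurd rfl h1
    | cons n w => exact ⟨⟨Gen.ofCode n, decodeLetters w⟩, h2⟩

theorem wordProblem_iff (p : List ℕ × List ℕ) :
    (∃ u v : Word, wordCode u = p.1 ∧ wordCode v = p.2 ∧ cls u = cls v) ↔
      ((p.1 ≠ [] ∧ (decodeLetters p.1).map (fun g => g.1.code) = p.1) ∧
      (p.2 ≠ [] ∧ (decodeLetters p.2).map (fun g => g.1.code) = p.2)) ∧
      normalize ((decodeLetters p.1).flatMap letterPath) =
        normalize ((decodeLetters p.2).flatMap letterPath) := by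
  rw [← exists_wordCode_iff, ← exists_wordCode_iff]
  obtain ⟨w, z⟩ := p
  constructor
  · rintro ⟨u, v, rfl, rfl, h⟩
    refine ⟨⟨⟨u, rfl⟩, ⟨v, rfl⟩⟩, ?_⟩
    rw [decodeLetters_wordCode, decodeLetters_wordCode]
    exact cls_eq_iff_normalize.1 h
  · rintro ⟨⟨⟨u, rfl⟩, ⟨v, rfl⟩⟩, h⟩
    rw [decodeLetters_wordCode, decodeLetters_wordCode] at h
    exact ⟨u, v, rfl, rfl, cls_eq_iff_normalize.2 h⟩

theorem primrec_decodeLetters : Primrec decodeLetters :=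
  Primrec.list_map .id (Gen.primrec_ofCode.comp .snd).to₂

theorem wordProblemDecidable : WordProblemDecidable := by
  have hw : PrimrecPred fun w : List ℕ =>
      w ≠ [] ∧ (decodeLetters w).map (fun g => g.1.code) = w :=
    (Primrec.eq.comp .id (.const [])).not.and (Primrec.eq.comp
      (Primrec.list_map primrec_decodeLetters (Gen.primrec_code.comp .snd).to₂) .id)
  have hn : Primrec fun w : List ℕ => normalize ((decodeLetters w).flatMap letterPath) :=
    primrec_normalize.comp (Primrec.list_flatMap primrec_decodeLetters
      (primrec_letterPath.comp .snd).to₂)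
  have h := (((hw.comp Primrec.fst).and (hw.comp Primrec.snd)).and
    (Primrec.eq.comp (hn.comp .fst) (hn.comp .snd))).of_eq fun p => (wordProblem_iff p).symm
  obtain ⟨hdec, h⟩ := h
  exact ⟨hdec, h.to_comp⟩

end FreeRegOne

theorem mainTheorem3 :
    (∀ u : FreeRegOne.Word, ∃! m : FreeRegOne.Word, FreeRegOne.IsNormalForm u m) ∧
    (∀ u : FreeRegOne.Word, FreeRegOne.IsNormalForm u (FreeRegOne.beta u) ∧
      FreeRegOne.IsMountain (FreeRegOne.beta u)) ∧
    (∀ u v : FreeRegOne.Word,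
      FreeRegOne.cls u = FreeRegOne.cls v ↔ FreeRegOne.beta u = FreeRegOne.beta v) ∧
    (∀ u : FreeRegOne.Word, ∀ m : FreeRegOne.Word,
      (FreeRegOne.IsMountain m ∧ FreeRegOne.cls m = FreeRegOne.cls u) ↔
        m = FreeRegOne.beta u) ∧
    FreeRegOne.WordProblemDecidable := by
  refine ⟨fun u => ?_, fun u => ?_, fun u v => ?_, fun u m => ?_, FreeRegOne.wordProblemDecidable⟩
  · exact ⟨_, FreeRegOne.isNormalForm_iff.2 rfl, fun _ => FreeRegOne.isNormalForm_iff.1⟩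
  · rw [FreeRegOne.beta_eq_mountain]
    exact ⟨FreeRegOne.isNormalForm_iff.2 rfl, FreeRegOne.isMountain_mountain u⟩
  · rw [FreeRegOne.beta_eq_mountain, FreeRegOne.beta_eq_mountain, FreeRegOne.cls_eq_iff_mountain]
  · rw [FreeRegOne.beta_eq_mountain]
    constructor
    · rintro ⟨hm, h⟩
      rw [← FreeRegOne.cls_eq_iff_mountain.1 h, hm.mountain_eq]
    · rintro rfl
      exact ⟨FreeRegOne.isMountain_mountain u, FreeRegOne.cls_mountain u⟩
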